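/- \textbf{TEF constraint.} Write $\llbracket x\rrbracket$ for the indicator function of the point $x\in[0,\infty)$. A line transition $g\to h$ between finitely supported functions $g,h:[0,\infty)\to[0,\infty)$ satisfies the \emph{TEF constraint} if it can be written as $$\sum_{i=1}^{n_k}p_{k_i}\llbracket x_{k_i}\rrbracket+\sum_{i=1}^{n_g}p_{g_i}\llbracket x_{g_i}\rrbracket\;\to\;\sum_{i=1}^{n_h}p_{h_i}\llbracket x_{h_i}\rrbracket+\sum_{i=1}^{n_k}p_{k_i}\llbracket x_{k_i}\rrbracket$$ with all weights $p$ positive, such that there is a unitary $U$ on the space with orthonormal basis $\{|g_i\rangle\}_{i=1}^{n_g}\cup\{|h_i\rangle\}_{i=1}^{n_h}$ with $$U\sum_i\sqrt{p_{g_i}}\,|g_i\rangle=\sum_i\sqrt{p_{h_i}}\,|h_i\rangle,\qquad \sum_i x_{h_i}|h_i\rangle\langle h_i|\;\ge\;\sum_i x_{g_i}\,E_hU|g_i\rangle\langle g_i|U^\dagger E_h,\qquad E_h=\sum_i|h_i\rangle\langle h_i| .$$ (The first condition includes $\sum_i p_{g_i}=\sum_i p_{h_i}$.) \textbf{Point game.}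 A time-dependent point game is a sequence $g_0,\dots,g_n$ of finitely supported functions $[0,\infty)^2\to[0,\infty)$ with $g_0=\frac12\llbracket 0,1\rrbracket+\frac12\llbracket 1,0\rrbracket$ and $g_n=\llbracket\beta,\alpha\rrbracket$ for some $\alpha,\beta\in[0,1]$. Assume that every transition satisfies the TEF constraint: for every even $i<n$ and every $x\ge0$ the line transition $g_i(x,\cdot)\to g_{i+1}(x,\cdot)$ satisfies it, and for every odd $i<n$ and every $y\ge0$ the line transition $g_i(\cdot,y)\to g_{i+1}(\cdot,y)$ satisfies it. \textbf{Protocol.} An $N$-message weak coin flipping (WCF) protocol, $N$ even, consists of finite-dimensional Hilbert spaces $A,M,B$, a product unit vector $|\psi_0\rangle=|\psi_{A,0}\rangle|\psi_{M,0}\rangle|\psi_{B,0}\rangle$, unitaries $U_1,\dots,U_N$ and projectors $E_1,\dots,E_N$, acting only on $A\otimes M$ for odd $i$ and only on $M\otimes B$ for even $i$, with $E_i|\psi_i\rangle=|\psi_i\rangle$ for $|\psi_i\rangle=U_i\cdots U_1|\psi_0\rangle$, and POVMs $\{\Pi_A^{(0)},\Pi_A^{(1)}\}$ on $A$, $\{\Pi_B^{(0)},\Pi_B^{(1)}\}$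 on $B$ with $\Pi_A^{(0)}\otimes\mathbb I_M\otimes\Pi_B^{(1)}|\psi_N\rangle=\Pi_A^{(1)}\otimes\mathbb I_M\otimes\Pi_B^{(0)}|\psi_N\rangle=0$ and $\|\Pi_A^{(j)}\otimes\mathbb I_M\otimes\Pi_B^{(j)}|\psi_N\rangle\|^2=\frac12$ for $j=0,1$. For $i=1,\dots,N$ the active party (Alice for odd $i$, Bob for even $i$) applies $U_i$, measures $\{E_i,\mathbb I-E_i\}$, declares themselves the winner on the second outcome, and otherwise passes $M$ on; finally both measure their POVMs. Outcome $0$ means that Alice wins and outcome $1$ that Bob wins. $P_B^*$ (resp. $P_A^*$) is the supremum, over all strategies of a cheating Bob (resp. Alice), who may use any finite-dimensional workspace, choose the joint initial state of the workspace and $M$ (as in the primal semidefinite program) and apply any unitary to them in each of their turns, of the probability that honest Alice outputs $1$ (resp. honest Bob outputs $0$). \emph{Dual feasible certificates} are positive semidefinite $Z_{A,0},\dots,Z_{A,N}$ on $A$ and $Z_{B,0},\dots,Z_{B,N}$ on $B$ with $Z_{A,N}=\Pi_A^{(1)}$, $Z_{B,N}=\Pi_B^{(0)}$ and, for $1\le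 i\le N$, \begin{itemize} \item for $i$ odd: $Z_{A,i-1}\otimes\mathbb I_M\ge U_i^\dagger E_i(Z_{A,i}\otimes\mathbb I_M)E_iU_i$ and $Z_{B,i-1}=Z_{B,i}$; \item for $i$ even: $\mathbb I_M\otimes Z_{B,i-1}\ge U_i^\dagger E_i(\mathbb I_M\otimes Z_{B,i})E_iU_i$ and $Z_{A,i-1}=Z_{A,i}$. \end{itemize} (Here $U_i,E_i$ are regarded as operators on $A\otimes M$, resp. $M\otimes B$.) The point game of the protocol and its certificates has the frames $f_j=\mathrm{Prob}[Z_{A,N-j},Z_{B,N-j},\psi_{N-j}]$, $j=0,\dots,N$, where $\mathrm{Prob}[Z_A,Z_B,\psi](z_A,z_B)=\langle\psi|\Pi_{Z_A}^{[z_A]}\otimes\mathbb I_M\otimes\Pi_{Z_B}^{[z_B]}|\psi\rangle$ and $\Pi_Z^{[z]}$ is the projector onto $\ker(Z-z)$. \textbf{Theorem.} If every transition of a time-dependent point game $g_0,\dots,g_n$ with final point $\llbracket\beta,\alpha\rrbracket$ satisfies the TEF constraint, then there are a WCF protocol and dual feasible certificates for it whose point game $f_0,\dots,f_N$ is $g_0,\dots,g_n$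 up to repeated frames: $f_j=g_{\sigma(j)}$ for a nondecreasing surjection $\sigma:\{0,\dots,N\}\to\{0,\dots,n\}$. The dual objective values are $\langle\psi_{A,0}|Z_{A,0}|\psi_{A,0}\rangle=\beta$ and $\langle\psi_{B,0}|Z_{B,0}|\psi_{B,0}\rangle=\alpha$, and hence $P_B^*\le\beta$ and $P_A^*\le\alpha$. -/

import Mathlib

open scoped NNReal ENNReal Kronecker Matrix ComplexOrder

noncomputable section

namespace WCF

/-! ### Finite-dimensional quantum mechanics in coordinates

A finite-dimensional Hilbert space with a fixed orthonormal basis is represented by the finite type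
of its basis labels: vectors are functions `ι → ℂ`, operators are matrices. The space
`A ⊗ M ⊗ B` has the label type `a × m × b`. -/

/-- The squared norm `⟨v|v⟩`. -/
def normSq {ι : Type} [Fintype ι] (v : ι → ℂ) : ℝ := ∑ i, ‖v i‖ ^ 2

/-- The expectation value `⟨v|M|v⟩` (real for Hermitian `M`). -/
def expect {ι : Type} [Fintype ι] (M : Matrix ι ι ℂ) (v : ι → ℂ) : ℝ :=
  (star v ⬝ᵥ (M *ᵥ v)).re

/-- The Loewner order `X ≥ Y`: the difference `X - Y` is positive semidefinite. -/
def LoewnerGE {ι : Type} [Fintype ι] (X Y : Matrix ι ι ℂ) : Prop := (X - Y).PosSemidef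

/-- `T ↦ T ⊗ 𝕀_B`, for an operator `T` on `A ⊗ M`. -/
def liftA {a m b : Type} [DecidableEq b] (T : Matrix (a × m) (a × m) ℂ) :
    Matrix (a × m × b) (a × m × b) ℂ :=
  Matrix.reindex (Equiv.prodAssoc a m b) (Equiv.prodAssoc a m b) (T ⊗ₖ (1 : Matrix b b ℂ))

/-- `T ↦ 𝕀_A ⊗ T`, for an operator `T` on `M ⊗ B`. -/
def liftB {a m b : Type} [DecidableEq a] (T : Matrix (m × b) (m × b) ℂ) :
    Matrix (a × m × b) (a × m × b) ℂ :=
  (1 : Matrix a a ℂ) ⊗ₖ T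

/-- The orthogonal projector `Π^[z]` onto the eigenspace of `Z` for `z`; it is `0` when `z` is not
an eigenvalue. -/
def eigProj {ι : Type} [Fintype ι] [DecidableEq ι] (Z : Matrix ι ι ℂ) (z : ℝ) : Matrix ι ι ℂ :=
  (Matrix.toEuclideanCLM (n := ι) (𝕜 := ℂ)).symm
    (Module.End.eigenspace (Matrix.toEuclideanLin Z) (z : ℂ)).starProjection

/-- `Prob[Z_A, Z_B, ψ](z_A, z_B) = ⟨ψ| Π^[z_A] ⊗ 𝕀_M ⊗ Π^[z_B] |ψ⟩`. -/
def prob {a m b : Type} [Fintype a] [Fintype m] [Fintype b]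
    [DecidableEq a] [DecidableEq m] [DecidableEq b]
    (ZA : Matrix a a ℂ) (ZB : Matrix b b ℂ) (ψ : a × m × b → ℂ) (z : ℝ≥0 × ℝ≥0) : ℝ :=
  expect (eigProj ZA z.1 ⊗ₖ ((1 : Matrix m m ℂ) ⊗ₖ eigProj ZB z.2)) ψ

/-! ### Point games -/

/-- `⟦x⟧`, the indicator function of the point `x`. -/
def mpoint (x : ℝ≥0) : ℝ≥0 → ℝ≥0 := fun z => if z = x then 1 else 0

/-- `∑ i, p i ⟦x i⟧`, the points `x i` on a line with weights `p i`. -/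
def linePoints {n : ℕ} (x p : Fin n → ℝ≥0) : ℝ≥0 → ℝ≥0 := fun z => ∑ i, p i * mpoint (x i) z

/-- The orthonormal basis `{|g_i⟩} ∪ {|h_i⟩}` is labelled by `Fin ng ⊕ Fin nh`. The matrix `U` on
its span solves the transition `∑ pg_i ⟦xg_i⟧ → ∑ ph_i ⟦xh_i⟧` if it is unitary,
`U |v⟩ = |w⟩` for `|v⟩ = ∑ √pg_i |g_i⟩` and `|w⟩ = ∑ √ph_i |h_i⟩`, and
`∑ xh_i |h_i⟩⟨h_i| ≥ ∑ xg_i E U |g_i⟩⟨g_i| U† E`, with `E` the projector on `span {|h_i⟩}`.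
The vectors `v` and `w` are not normalised; in terms of normalised vectors the second condition
says that `∑ pg_i = ∑ ph_i` and that `U` maps one normalised vector to the other. -/
def Solves {ng nh : ℕ} (xg pg : Fin ng → ℝ≥0) (xh ph : Fin nh → ℝ≥0)
    (U : Matrix (Fin ng ⊕ Fin nh) (Fin ng ⊕ Fin nh) ℂ) : Prop :=
  let v : Fin ng ⊕ Fin nh → ℂ := Sum.elim (fun i => ((√(pg i : ℝ) : ℝ) : ℂ)) (fun _ => 0)
  let w : Fin ng ⊕ Fin nh → ℂ := Sum.elim (fun _ => 0) (fun i => ((√(ph i : ℝ) : ℝ) : ℂ))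
  let E : Matrix (Fin ng ⊕ Fin nh) (Fin ng ⊕ Fin nh) ℂ :=
    ∑ i, Matrix.single (Sum.inr i) (Sum.inr i) 1
  U ∈ Matrix.unitaryGroup (Fin ng ⊕ Fin nh) ℂ ∧
  U *ᵥ v = w ∧
  LoewnerGE
    (∑ i, ((xh i : ℝ) : ℂ) • Matrix.single (Sum.inr i) (Sum.inr i) (1 : ℂ))
    (∑ i, ((xg i : ℝ) : ℂ) •
      (E * U * Matrix.single (Sum.inl i) (Sum.inl i) (1 : ℂ) * Uᴴ * E))

/-- The TEF constraint for a line transition `g → h`: it can be written as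
`∑ pk_i ⟦xk_i⟧ + ∑ pg_i ⟦xg_i⟧ → ∑ ph_i ⟦xh_i⟧ + ∑ pk_i ⟦xk_i⟧`, where the points `xk_i` are left
unchanged, and some unitary solves the transition of the remaining points. -/
def TEFLine (g h : ℝ≥0 → ℝ≥0) : Prop :=
  ∃ (nk ng nh : ℕ) (xk pk : Fin nk → ℝ≥0) (xg pg : Fin ng → ℝ≥0) (xh ph : Fin nh → ℝ≥0),
    (∀ i, 0 < pk i) ∧ (∀ i, 0 < pg i) ∧ (∀ i, 0 < ph i) ∧
    g = linePoints xk pk + linePoints xg pg ∧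
    h = linePoints xh ph + linePoints xk pk ∧
    ∃ U, Solves xg pg xh ph U

/-- A frame: a finitely supported function `[0,∞) × [0,∞) → [0,∞)`. -/
abbrev Frame := (ℝ≥0 × ℝ≥0) →₀ ℝ≥0

/-- A horizontal transition satisfying the TEF constraint on every horizontal line. -/
def TEFHorizontal (g h : Frame) : Prop := ∀ y, TEFLine (fun x => g (x, y)) (fun x => h (x, y))

/-- A vertical transition satisfying the TEF constraint on every vertical line. -/
def TEFVertical (g h : Frame) : Prop := ∀ x, TEFLine (fun y => g (x, y)) (fun y => h (x, y))

/-- The frames `g_0, …, g_n` of a time-dependent point game with final point `⟦β, α⟧`. The rule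
that the transitions obey is stated separately. -/
structure PointGame where
  n : ℕ
  frame : ℕ → Frame
  β : ℝ≥0
  α : ℝ≥0
  β_le : β ≤ 1
  α_le : α ≤ 1
  initial : frame 0 = Finsupp.single (0, 1) (1 / 2) + Finsupp.single (1, 0) (1 / 2)
  final : frame n = Finsupp.single (β, α) 1

/-- Every transition satisfies the TEF constraint; `g_i → g_{i+1}` is vertical for even `i` and
horizontal for odd `i`. -/
def PointGame.IsTEF (G : PointGame) : Prop :=
  ∀ i < G.n,
    (Even i → TEFVertical (G.frame i) (G.frame (i + 1))) ∧
    (Odd i → TEFHorizontal (G.frame i) (G.frame (i + 1)))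

/-! ### Weak coin flipping protocols -/

/-- The data of an `n`-message protocol. In message `i`, for `1 ≤ i ≤ n`, Alice (`i` odd) applies
`UA i` and the measurement `{EA i, 1 - EA i}` on `A ⊗ M`, and Bob (`i` even) applies `UB i` and
`{EB i, 1 - EB i}` on `M ⊗ B`; the values at other indices play no role. `PA` and `PB` are the
final measurements, with outcome `0` when Alice wins and `1` when Bob wins. -/
structure ProtocolData (a m b : Type) where
  n : ℕ
  ψA : a → ℂ
  ψM : m → ℂ
  ψB : b → ℂ
  UA : ℕ → Matrix (a × m) (a × m) ℂ
  UB : ℕ → Matrix (m × b) (m × b) ℂ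
  EA : ℕ → Matrix (a × m) (a × m) ℂ
  EB : ℕ → Matrix (m × b) (m × b) ℂ
  PA : Fin 2 → Matrix a a ℂ
  PB : Fin 2 → Matrix b b ℂ

section
variable {a m b : Type} [Fintype a] [Fintype m] [Fintype b]
  [DecidableEq a] [DecidableEq m] [DecidableEq b]

/-- The honest states `|ψ_i⟩ = U_i ⋯ U_1 |ψ_0⟩`, with `|ψ_0⟩ = |ψ_A⟩|ψ_M⟩|ψ_B⟩`. -/
def ProtocolData.honest (P : ProtocolData a m b) : ℕ → (a × m × b → ℂ)
  | 0 => fun s => P.ψA s.1 * P.ψM s.2.1 * P.ψB s.2.2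
  | i + 1 =>
    if Odd (i + 1) then liftA (P.UA (i + 1)) *ᵥ P.honest i
    else liftB (P.UB (i + 1)) *ᵥ P.honest i

/-- `Π_A^(j) ⊗ 𝕀_M ⊗ Π_B^(k)`. -/
def ProtocolData.joint (P : ProtocolData a m b) (j k : Fin 2) :
    Matrix (a × m × b) (a × m × b) ℂ :=
  P.PA j ⊗ₖ ((1 : Matrix m m ℂ) ⊗ₖ P.PB k)

variable (a m b) in
/-- A weak coin flipping protocol with an even number of messages, correct and balanced. -/
structure Protocol extends ProtocolData a m b where
  n_even : Even n
  ψA_unit : normSq ψA = 1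
  ψM_unit : normSq ψM = 1
  ψB_unit : normSq ψB = 1
  UA_unitary : ∀ i ≤ n, Odd i → UA i ∈ Matrix.unitaryGroup (a × m) ℂ
  UB_unitary : ∀ i ≤ n, Even i → 0 < i → UB i ∈ Matrix.unitaryGroup (m × b) ℂ
  EA_proj : ∀ i ≤ n, Odd i → IsStarProjection (EA i)
  EB_proj : ∀ i ≤ n, Even i → 0 < i → IsStarProjection (EB i)
  EA_honest : ∀ i ≤ n, Odd i → liftA (EA i) *ᵥ toProtocolData.honest i = toProtocolData.honest i
  EB_honest : ∀ i ≤ n, Even i → 0 < i →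
    liftB (EB i) *ᵥ toProtocolData.honest i = toProtocolData.honest i
  PA_psd : ∀ j, (PA j).PosSemidef
  PB_psd : ∀ j, (PB j).PosSemidef
  PA_sum : PA 0 + PA 1 = 1
  PB_sum : PB 0 + PB 1 = 1
  correct₀₁ : toProtocolData.joint 0 1 *ᵥ toProtocolData.honest n = 0
  correct₁₀ : toProtocolData.joint 1 0 *ᵥ toProtocolData.honest n = 0
  balanced₀ : normSq (toProtocolData.joint 0 0 *ᵥ toProtocolData.honest n) = 1 / 2
  balanced₁ : normSq (toProtocolData.joint 1 1 *ᵥ toProtocolData.honest n) = 1 / 2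

/-- The (unnormalised) joint state after `i` messages when Alice is honest and all her checks so far
have passed, while a cheating Bob has a workspace of dimension `d`, starts from the state `χ` of
`M` and his workspace, and applies `V i` for even `i`. -/
def Protocol.stateBobCheats (P : Protocol a m b) {d : ℕ} (χ : m × Fin d → ℂ)
    (V : ℕ → Matrix (m × Fin d) (m × Fin d) ℂ) : ℕ → (a × m × Fin d → ℂ)
  | 0 => fun s => P.ψA s.1 * χ s.2
  | i + 1 =>
    if Odd (i + 1) then liftA (P.EA (i + 1) * P.UA (i + 1)) *ᵥ P.stateBobCheats χ V i
    else liftB (V (i + 1)) *ᵥ P.stateBobCheats χ V i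

/-- The same with the roles of Alice and Bob exchanged: Alice applies `V i` for odd `i`. -/
def Protocol.stateAliceCheats (P : Protocol a m b) {d : ℕ} (χ : Fin d × m → ℂ)
    (V : ℕ → Matrix (Fin d × m) (Fin d × m) ℂ) : ℕ → (Fin d × m × b → ℂ)
  | 0 => fun s => χ (s.1, s.2.1) * P.ψB s.2.2
  | i + 1 =>
    if Odd (i + 1) then liftA (V (i + 1)) *ᵥ P.stateAliceCheats χ V i
    else liftB (P.EB (i + 1) * P.UB (i + 1)) *ᵥ P.stateAliceCheats χ V i

/-- `P_B^*`: the supremum, over all strategies of a cheating Bob, of the probability that the honest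
Alice does not abort and outputs `1`. The cheater may choose the initial state of the message space
too; strategies starting from the prescribed `ψM` are those with `χ = ψM ⊗ φ`. -/
def Protocol.cheatB (P : Protocol a m b) : ℝ≥0∞ :=
  ⨆ (d : ℕ) (χ : m × Fin d → ℂ) (_ : normSq χ = 1)
    (V : ℕ → Matrix (m × Fin d) (m × Fin d) ℂ)
    (_ : ∀ i, V i ∈ Matrix.unitaryGroup (m × Fin d) ℂ),
    ENNReal.ofReal (expect (P.PA 1 ⊗ₖ (1 : Matrix (m × Fin d) (m × Fin d) ℂ))
      (P.stateBobCheats χ V P.n))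

/-- `P_A^*`: the supremum, over all strategies of a cheating Alice, of the probability that the
honest Bob does not abort and outputs `0`. -/
def Protocol.cheatA (P : Protocol a m b) : ℝ≥0∞ :=
  ⨆ (d : ℕ) (χ : Fin d × m → ℂ) (_ : normSq χ = 1)
    (V : ℕ → Matrix (Fin d × m) (Fin d × m) ℂ)
    (_ : ∀ i, V i ∈ Matrix.unitaryGroup (Fin d × m) ℂ),
    ENNReal.ofReal (expect ((1 : Matrix (Fin d) (Fin d) ℂ) ⊗ₖ ((1 : Matrix m m ℂ) ⊗ₖ P.PB 0))
      (P.stateAliceCheats χ V P.n))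

/-- `ZA 0, …, ZA n` and `ZB 0, …, ZB n` are feasible for the two dual semidefinite programs of the
protocol. -/
structure Protocol.IsDualFeasible (P : Protocol a m b)
    (ZA : ℕ → Matrix a a ℂ) (ZB : ℕ → Matrix b b ℂ) : Prop where
  psdA : ∀ i ≤ P.n, (ZA i).PosSemidef
  psdB : ∀ i ≤ P.n, (ZB i).PosSemidef
  stepA : ∀ i < P.n, Odd (i + 1) →
    LoewnerGE (ZA i ⊗ₖ (1 : Matrix m m ℂ))
      ((P.UA (i + 1))ᴴ * P.EA (i + 1) * (ZA (i + 1) ⊗ₖ (1 : Matrix m m ℂ))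
        * P.EA (i + 1) * P.UA (i + 1))
  idleA : ∀ i < P.n, Even (i + 1) → ZA i = ZA (i + 1)
  finalA : ZA P.n = P.PA 1
  stepB : ∀ i < P.n, Even (i + 1) →
    LoewnerGE ((1 : Matrix m m ℂ) ⊗ₖ ZB i)
      ((P.UB (i + 1))ᴴ * P.EB (i + 1) * ((1 : Matrix m m ℂ) ⊗ₖ ZB (i + 1))
        * P.EB (i + 1) * P.UB (i + 1))
  idleB : ∀ i < P.n, Odd (i + 1) → ZB i = ZB (i + 1)
  finalB : ZB P.n = P.PB 0

/-- The point game of a protocol with dual certificates, whose frames are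
`Prob[Z_{A,n-j}, Z_{B,n-j}, ψ_{n-j}]` for `j = 0, …, n` (in the reverse time order), is the game `G`
with some of its frames repeated. -/
def Protocol.HasPointGame (P : Protocol a m b)
    (ZA : ℕ → Matrix a a ℂ) (ZB : ℕ → Matrix b b ℂ) (G : PointGame) : Prop :=
  ∃ σ : Fin (P.n + 1) → Fin (G.n + 1), Monotone σ ∧ Function.Surjective σ ∧
    ∀ (j : Fin (P.n + 1)) (z : ℝ≥0 × ℝ≥0),
      prob (ZA (P.n - j)) (ZB (P.n - j)) (P.honest (P.n - j)) z = (G.frame (σ j) z : ℝ)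

end

end WCF

end

namespace WCF

/-! The protocol plays the point game backwards in time. The possible first coordinates `S` and
second coordinates `T` become label sets, and a frame `f` becomes the state `∑ √(f s t) |s⟩|s,
t⟩|t⟩`: each party stores its own coordinate and the message carries both. The final frame is a
single point, so the starting state is a product. With certificates diagonal in the labels, equal to
the positions, `Prob` reads the frame off the state, and the initial dual values are the coordinates
`β` and `α`.

What a message needs from a line transition is only the contraction in `Dominates`. If `U` solves
the transition, the block of `Uᴴ` from the `h` labels to the `g` labels is such a contraction: it
sends the `h` amplitudes to the `g` amplitudes, and the TEF operator inequality bounds the expected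
position (`Solves.dominates`). Unlike the unitary, the contraction composes, so unchanged points can
be added and coinciding points split or merged (`TEFLine.dominates`). The result lives on fixed
label sets, as one protocol requires.

For one message (`exists_step`), choose a contraction `K t` for each label `t` of the other party
and complete it by `D t` with `(K t)ᴴ K t + (D t)ᴴ D t = 1`. The dilation `V` is an isometry that
sends the `D` part to the register label `none`, and `J` is the isometry onto states whose register
agrees with the message. A unitary `U` extends `J ↦ V`, and the check is `E = V Vᴴ`, so that `E U =
V Jᴴ`. The certificate vanishes at `none`, hence dual feasibility reduces to the position bounds for
the `K t`. On honest states the `D` part is zero, because `K t` preserves the norm of the honest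
amplitudes.

The last certificates must be the final measurements, here with values `0` and `1` instead of
positions. Two extra copies of the first frame make room for this change: that frame has only
coordinates `0` and `1`, where the indicator of position `1` equals the position, and elsewhere the
indicator is smaller, which feasibility allows. The cheating bounds then follow by weak duality. -/

/-! ### Contractions between families of weighted points -/

/-- The matrix `K` carries the amplitudes of the weighted points `(y, q)` to those of `(x, p)`
without increasing the norm or the expected position. -/
def Dominates {ι κ : Type} [Fintype ι] [Fintype κ] (x p : ι → ℝ≥0) (y q : κ → ℝ≥0) : Prop :=
  (∑ i, p i = ∑ j, q j) ∧ ∃ K : Matrix ι κ ℂ,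
    (K *ᵥ (fun j => ((√(q j : ℝ) : ℝ) : ℂ)) = fun i => ((√(p i : ℝ) : ℝ) : ℂ)) ∧
    (∀ u, ∑ i, ‖(K *ᵥ u) i‖ ^ 2 ≤ ∑ j, ‖u j‖ ^ 2) ∧
    (∀ u, ∑ i, (x i : ℝ) * ‖(K *ᵥ u) i‖ ^ 2 ≤ ∑ j, (y j : ℝ) * ‖u j‖ ^ 2)

theorem Dominates.refl {ι : Type} [Fintype ι] (x p : ι → ℝ≥0) : Dominates x p x p := by
  classical
  exact ⟨rfl, 1, by simp, by simp, by simp⟩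

theorem Dominates.trans {ι κ μ : Type} [Fintype ι] [Fintype κ] [Fintype μ]
    {x p : ι → ℝ≥0} {y q : κ → ℝ≥0} {z r : μ → ℝ≥0}
    (h₁ : Dominates x p y q) (h₂ : Dominates y q z r) : Dominates x p z r := by
  obtain ⟨s₁, K, a₁, b₁, c₁⟩ := h₁
  obtain ⟨s₂, K', a₂, b₂, c₂⟩ := h₂
  refine ⟨s₁.trans s₂, K * K', ?_, fun u => ?_, fun u => ?_⟩
  · rw [← Matrix.mulVec_mulVec, a₂, a₁]
  · rw [← Matrix.mulVec_mulVec]; exact (b₁ _).trans (b₂ _)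
  · rw [← Matrix.mulVec_mulVec]; exact (c₁ _).trans (c₂ _)

/-- The line function of a family of weighted points. -/
noncomputable def familyPoints {ι : Type} [Fintype ι] (x p : ι → ℝ≥0) (z : ℝ≥0) : ℝ≥0 :=
  ∑ i, p i * mpoint (x i) z

theorem le_familyPoints {ι : Type} [Fintype ι] (x p : ι → ℝ≥0) (i : ι) :
    p i ≤ familyPoints x p (x i) := by
  have := Finset.single_le_sum (f := fun j => p j * mpoint (x j) (x i))
    (fun _ _ => zero_le) (Finset.mem_univ i)
  simpa [familyPoints, mpoint] using this

/-! ### Splitting and merging points at the same position -/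

section regroup
variable {ι σ : Type} [Fintype ι] {x p : ι → ℝ≥0} {c : σ → ℝ≥0}

theorem sum_familyPoints [Fintype σ] (hc : Function.Injective c)
    (hcov : ∀ z, familyPoints x p z ≠ 0 → ∃ s, c s = z) :
    ∑ s, familyPoints x p (c s) = ∑ i, p i := by
  classical
  simp only [familyPoints]
  rw [Finset.sum_comm]
  refine Finset.sum_congr rfl fun i _ => ?_
  by_cases hp : p i = 0
  · simp [hp]
  · obtain ⟨s, hs⟩ := hcov (x i) (by
      have := le_familyPoints x p i
      exact (lt_of_lt_of_le (pos_iff_ne_zero.2 hp) this).ne')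
    rw [Finset.sum_eq_single s]
    · simp [mpoint, hs]
    · intro t _ ht
      have : c t ≠ x i := fun h => ht (hc (h.trans hs.symm))
      simp [mpoint, this]
    · simp

open Classical in
/-- Splits the point at `c s` into the points of the family at the same position. -/
noncomputable def splitMatrix (x p : ι → ℝ≥0) (c : σ → ℝ≥0) : Matrix ι σ ℂ := fun i s =>
  if c s = x i then ((√((p i / familyPoints x p (c s) : ℝ≥0) : ℝ) : ℝ) : ℂ) else 0

/-- The squared entries of column `s` are the shares of the weight at `c s`, so they add up to `1`.
If that weight is zero, division by zero makes the column vanish, hence only an inequality. -/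
theorem splitMatrix_normSq_sum_le (s : σ) :
    ∑ i, ‖splitMatrix x p c i s‖ ^ 2 ≤ 1 := by
  classical
  have h : ∀ i, ‖splitMatrix x p c i s‖ ^ 2 =
      ((p i * mpoint (x i) (c s) / familyPoints x p (c s) : ℝ≥0) : ℝ) := by
    intro i
    unfold splitMatrix mpoint
    split_ifs with h
    · rw [Complex.norm_real, Real.norm_eq_abs, sq_abs, Real.sq_sqrt (NNReal.coe_nonneg _), mul_one]
    · simp
  simp only [h]
  rw [← NNReal.coe_sum, ← Finset.sum_div]
  exact_mod_cast div_self_le_one (familyPoints x p (c s))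

theorem splitMatrix_mulVec_sqrt [Fintype σ] (hc : Function.Injective c)
    (hcov : ∀ z, familyPoints x p z ≠ 0 → ∃ s, c s = z) :
    splitMatrix x p c *ᵥ (fun s => ((√(familyPoints x p (c s) : ℝ) : ℝ) : ℂ)) =
      fun i => ((√(p i : ℝ) : ℝ) : ℂ) := by
  classical
  ext i
  simp only [Matrix.mulVec, dotProduct]
  by_cases hp : p i = 0
  · rw [Finset.sum_eq_zero]
    · simp [hp]
    · intro s _; simp [splitMatrix, hp]
  · have hpos : familyPoints x p (x i) ≠ 0 :=
      (lt_of_lt_of_le (pos_iff_ne_zero.2 hp) (le_familyPoints x p i)).ne'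
    obtain ⟨s, hs⟩ := hcov (x i) hpos
    rw [Finset.sum_eq_single s]
    · simp only [splitMatrix, hs, if_true]
      rw [← Complex.ofReal_mul, ← Real.sqrt_mul (NNReal.coe_nonneg _), ← NNReal.coe_mul,
        div_mul_cancel₀ _ hpos]
    · intro t _ ht
      have : c t ≠ x i := fun h => ht (hc (h.trans hs.symm))
      simp [splitMatrix, this]
    · simp

/-- Since `c` is injective, each row has at most one nonzero entry, so no cross terms appear. -/
theorem splitMatrix_mulVec_norm_sq [Fintype σ] (hc : Function.Injective c) (u : σ → ℂ) (i : ι) :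
    ‖(splitMatrix x p c *ᵥ u) i‖ ^ 2 = ∑ s, ‖splitMatrix x p c i s‖ ^ 2 * ‖u s‖ ^ 2 := by
  classical
  simp only [Matrix.mulVec, dotProduct]
  by_cases h : ∃ s, c s = x i
  · obtain ⟨s, hs⟩ := h
    have hz : ∀ t, t ≠ s → splitMatrix x p c i t = 0 := fun t ht => by
      have : c t ≠ x i := fun h => ht (hc (h.trans hs.symm))
      simp [splitMatrix, this]
    rw [Finset.sum_eq_single s, Finset.sum_eq_single s, norm_mul, mul_pow]
    · intro t _ ht; simp [hz t ht]
    · simp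
    · intro t _ ht; simp [hz t ht]
    · simp
  · push Not at h
    have hz : ∀ t, splitMatrix x p c i t = 0 := fun t => by simp [splitMatrix, h t]
    simp [hz]

theorem splitMatrix_weight (φ : ℝ≥0 → ℝ) (i : ι) (s : σ) :
    φ (x i) * ‖splitMatrix x p c i s‖ ^ 2 = φ (c s) * ‖splitMatrix x p c i s‖ ^ 2 := by
  unfold splitMatrix
  split_ifs with h
  · rw [h]
  · simp

/-- The matrix connects only equal positions, so any weight `φ` passes through it. `φ = 1` gives the
norm bound and the identity gives the position bound of `Dominates`. -/
theorem splitMatrix_mulVec_le [Fintype σ] (hc : Function.Injective c) (φ : ℝ≥0 → ℝ) (hφ : ∀ z, 0 ≤ φ z)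
    (u : σ → ℂ) :
    ∑ i, φ (x i) * ‖(splitMatrix x p c *ᵥ u) i‖ ^ 2 ≤ ∑ s, φ (c s) * ‖u s‖ ^ 2 := by
  simp only [splitMatrix_mulVec_norm_sq hc, Finset.mul_sum, ← mul_assoc]
  rw [Finset.sum_comm]
  refine Finset.sum_le_sum fun s _ => ?_
  calc _ = φ (c s) * (∑ i, ‖splitMatrix x p c i s‖ ^ 2) * ‖u s‖ ^ 2 := by
        rw [Finset.mul_sum, Finset.sum_mul]
        exact Finset.sum_congr rfl fun i _ => by rw [splitMatrix_weight φ]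
    _ ≤ φ (c s) * 1 * ‖u s‖ ^ 2 := by
        gcongr
        · exact hφ _
        · exact splitMatrix_normSq_sum_le s
    _ = _ := by rw [mul_one]

/-- Splitting the points of a line. -/
theorem dominates_split [Fintype σ] (hc : Function.Injective c)
    (hcov : ∀ z, familyPoints x p z ≠ 0 → ∃ s, c s = z) :
    Dominates x p c (fun s => familyPoints x p (c s)) := by
  refine ⟨(sum_familyPoints hc hcov).symm, splitMatrix x p c, splitMatrix_mulVec_sqrt hc hcov,
    fun u => ?_, fun u => ?_⟩
  · simpa using splitMatrix_mulVec_le (x := x) (p := p) hc (fun _ => 1) (fun _ => zero_le_one) u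
  · exact splitMatrix_mulVec_le (x := x) (p := p) hc (fun z => (z : ℝ)) (fun z => z.2) u

/-- Cauchy–Schwarz in each column, whose norm is at most `1`; by injectivity of `c` each point `i`
is counted for at most one `s`. -/
theorem splitMatrix_conjTranspose_mulVec_le [Fintype σ] (hc : Function.Injective c) (φ : ℝ≥0 → ℝ)
    (hφ : ∀ z, 0 ≤ φ z) (v : ι → ℂ) :
    ∑ s, φ (c s) * ‖((splitMatrix x p c)ᴴ *ᵥ v) s‖ ^ 2 ≤ ∑ i, φ (x i) * ‖v i‖ ^ 2 := by
  classical
  have key : ∀ s, ‖((splitMatrix x p c)ᴴ *ᵥ v) s‖ ^ 2 ≤ ∑ i, if c s = x i then ‖v i‖ ^ 2 else 0 := by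
    intro s
    have h1 : ‖((splitMatrix x p c)ᴴ *ᵥ v) s‖ ≤
        ∑ i, ‖splitMatrix x p c i s‖ * (if c s = x i then ‖v i‖ else 0) := by
      refine (norm_sum_le _ _).trans (Finset.sum_le_sum fun i _ => ?_)
      simp only [Matrix.conjTranspose_apply, norm_mul, norm_star]
      split_ifs with h
      · rfl
      · simp [splitMatrix, h]
    calc _ ≤ (∑ i, ‖splitMatrix x p c i s‖ * (if c s = x i then ‖v i‖ else 0)) ^ 2 := by gcongr
      _ ≤ (∑ i, ‖splitMatrix x p c i s‖ ^ 2) * ∑ i, (if c s = x i then ‖v i‖ else 0) ^ 2 :=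
        Finset.sum_mul_sq_le_sq_mul_sq _ _ _
      _ ≤ 1 * ∑ i, (if c s = x i then ‖v i‖ else 0) ^ 2 := by
        gcongr
        exact splitMatrix_normSq_sum_le s
      _ = _ := by simp [ite_pow]
  calc _ ≤ ∑ s, φ (c s) * ∑ i, (if c s = x i then ‖v i‖ ^ 2 else 0) := by
        gcongr with s
        · exact hφ _
        · exact key s
    _ = ∑ i, ∑ s, (if c s = x i then φ (x i) * ‖v i‖ ^ 2 else 0) := by
        rw [Finset.sum_comm]
        refine Finset.sum_congr rfl fun s _ => ?_
        rw [Finset.mul_sum]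
        refine Finset.sum_congr rfl fun i _ => ?_
        split_ifs with h
        · rw [h]
        · simp
    _ ≤ _ := by
        refine Finset.sum_le_sum fun i _ => ?_
        by_cases h : ∃ s, c s = x i
        · obtain ⟨s, hs⟩ := h
          rw [Finset.sum_eq_single s]
          · simp [hs]
          · intro t _ ht
            have : c t ≠ x i := fun h => ht (hc (h.trans hs.symm))
            simp [this]
          · simp
        · push Not at h
          simp only [h, if_false, Finset.sum_const_zero]
          exact mul_nonneg (hφ _) (sq_nonneg _)

theorem splitMatrix_conjTranspose_mulVec_sqrt :
    (splitMatrix x p c)ᴴ *ᵥ (fun i => ((√(p i : ℝ) : ℝ) : ℂ)) =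
      fun s => ((√(familyPoints x p (c s) : ℝ) : ℝ) : ℂ) := by
  classical
  ext s
  have h : ∀ i, (splitMatrix x p c)ᴴ s i * ((√(p i : ℝ) : ℝ) : ℂ) =
      (((p i * mpoint (x i) (c s) : ℝ≥0) : ℝ) / √(familyPoints x p (c s) : ℝ) : ℝ) := by
    intro i
    simp only [Matrix.conjTranspose_apply, splitMatrix, mpoint]
    split_ifs with h
    · rw [RCLike.star_def, Complex.conj_ofReal, ← Complex.ofReal_mul, NNReal.coe_div,
        Real.sqrt_div (NNReal.coe_nonneg _), div_mul_eq_mul_div,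
        Real.mul_self_sqrt (NNReal.coe_nonneg _), mul_one]
    · simp
  simp only [Matrix.mulVec, dotProduct, h]
  rw [← Complex.ofReal_sum, ← Finset.sum_div, ← NNReal.coe_sum]
  exact congrArg _ (Real.div_sqrt)

/-- Merging points at the same position. -/
theorem dominates_merge [Fintype σ] (hc : Function.Injective c)
    (hcov : ∀ z, familyPoints x p z ≠ 0 → ∃ s, c s = z) :
    Dominates c (fun s => familyPoints x p (c s)) x p := by
  refine ⟨sum_familyPoints hc hcov, (splitMatrix x p c)ᴴ, splitMatrix_conjTranspose_mulVec_sqrt,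
    fun u => ?_, fun u => ?_⟩
  · simpa using splitMatrix_conjTranspose_mulVec_le (x := x) (p := p) hc (fun _ => 1)
      (fun _ => zero_le_one) u
  · exact splitMatrix_conjTranspose_mulVec_le (x := x) (p := p) hc (fun z => (z : ℝ))
      (fun z => z.2) u

end regroup

/-- Adding points that stay where they are. -/
theorem Dominates.sumElim {ι κ μ : Type} [Fintype ι] [Fintype κ] [Fintype μ]
    {x p : ι → ℝ≥0} {y q : κ → ℝ≥0} (h : Dominates x p y q) (z r : μ → ℝ≥0) :
    Dominates (Sum.elim x z) (Sum.elim p r) (Sum.elim y z) (Sum.elim q r) := by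
  classical
  obtain ⟨s, K, a, b, c⟩ := h
  have hmul : ∀ u : κ ⊕ μ → ℂ, Matrix.fromBlocks K 0 0 1 *ᵥ u =
      Sum.elim (K *ᵥ (u ∘ Sum.inl)) (u ∘ Sum.inr) := by
    intro u
    simp [Matrix.fromBlocks_mulVec]
  refine ⟨by simp [Fintype.sum_sum_type, s], Matrix.fromBlocks K 0 0 1, ?_, fun u => ?_, fun u => ?_⟩
  · rw [hmul]
    ext (i | i)
    · exact congrFun a i
    · rfl
  · simp only [hmul, Fintype.sum_sum_type, Sum.elim_inl, Sum.elim_inr]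
    exact add_le_add_left (b (u ∘ Sum.inl)) _
  · simp only [hmul, Fintype.sum_sum_type, Sum.elim_inl, Sum.elim_inr]
    exact add_le_add_left (c (u ∘ Sum.inl)) _

/-! ### Expectation values, and the contraction extracted from a TEF unitary -/

theorem ofReal_normSq {ι : Type} [Fintype ι] (v : ι → ℂ) : ((normSq v : ℝ) : ℂ) = star v ⬝ᵥ v := by
  simp only [normSq, Complex.ofReal_sum, dotProduct]
  refine Finset.sum_congr rfl fun i _ => ?_
  rw [Complex.ofReal_pow, ← Complex.conj_mul']
  rfl

theorem normSq_mulVec_of_isometry {ι κ : Type} [Fintype ι] [Fintype κ] [DecidableEq κ]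
    {V : Matrix ι κ ℂ} (hV : Vᴴ * V = 1) (u : κ → ℂ) : normSq (V *ᵥ u) = normSq u := by
  apply Complex.ofReal_injective
  rw [ofReal_normSq, ofReal_normSq, Matrix.star_mulVec, ← Matrix.dotProduct_mulVec,
    Matrix.mulVec_mulVec, hV, Matrix.one_mulVec]

theorem expect_conj {ι κ : Type} [Fintype ι] [Fintype κ] (M : Matrix ι ι ℂ) (B : Matrix ι κ ℂ)
    (u : κ → ℂ) : expect (Bᴴ * M * B) u = expect M (B *ᵥ u) := by
  unfold expect
  rw [Matrix.star_mulVec, ← Matrix.dotProduct_mulVec, Matrix.mulVec_mulVec, Matrix.mulVec_mulVec,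
    Matrix.mul_assoc]

theorem expect_sub {ι : Type} [Fintype ι] (M N : Matrix ι ι ℂ) (u : ι → ℂ) :
    expect (M - N) u = expect M u - expect N u := by
  simp [expect, Matrix.sub_mulVec]

theorem LoewnerGE.expect_le {ι : Type} [Fintype ι] {M N : Matrix ι ι ℂ} (h : LoewnerGE M N)
    (u : ι → ℂ) : expect N u ≤ expect M u := by
  have := (Complex.le_def.1 (Matrix.PosSemidef.dotProduct_mulVec_nonneg h u)).1
  have h2 : 0 ≤ expect (M - N) u := this
  rw [expect_sub] at h2
  linarith

theorem expect_diagonal {ι : Type} [Fintype ι] [DecidableEq ι] (d : ι → ℝ) (u : ι → ℂ) :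
    expect (Matrix.diagonal fun i => (d i : ℂ)) u = ∑ i, d i * ‖u i‖ ^ 2 := by
  simp only [expect, Matrix.mulVec_diagonal, dotProduct, Complex.re_sum]
  refine Finset.sum_congr rfl fun i _ => ?_
  rw [Pi.star_apply, RCLike.star_def, mul_left_comm, Complex.conj_mul', ← Complex.ofReal_pow,
    ← Complex.ofReal_mul, Complex.ofReal_re]

theorem sum_smul_single_eq_diagonal {ι κ : Type} [Fintype ι] [Fintype κ] [DecidableEq κ]
    [DecidableEq ι] (f : ι → κ) (hf : Function.Injective f) (c : ι → ℂ) (d : κ → ℂ)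
    (hd : ∀ i, d (f i) = c i) (hd' : ∀ k, k ∉ Set.range f → d k = 0) :
    ∑ i, c i • Matrix.single (f i) (f i) (1 : ℂ) = Matrix.diagonal d := by
  ext k l
  simp only [Matrix.sum_apply, Matrix.smul_apply, Matrix.single_apply, Matrix.diagonal_apply]
  by_cases h : k ∈ Set.range f
  · obtain ⟨i, rfl⟩ := h
    rw [Finset.sum_eq_single i]
    · simp [hd]
    · intro j _ hj; simp [hf.ne hj]
    · simp
  · rw [hd' k h, Finset.sum_eq_zero]
    · simp
    · intro j _
      have : f j ≠ k := fun e => h ⟨j, e⟩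
      simp [this]

/-- A unitary solving a transition carries the amplitudes of the final points backwards. -/
theorem Solves.dominates {ng nh : ℕ} {xg pg : Fin ng → ℝ≥0} {xh ph : Fin nh → ℝ≥0}
    {U : Matrix (Fin ng ⊕ Fin nh) (Fin ng ⊕ Fin nh) ℂ} (h : Solves xg pg xh ph U) :
    Dominates xg pg xh ph := by
  obtain ⟨hU, hvw, hX⟩ := h
  have hUU : Uᴴ * U = 1 := Matrix.mem_unitaryGroup_iff'.1 hU
  have hUU' : Uᴴᴴ * Uᴴ = 1 := by
    rw [Matrix.conjTranspose_conjTranspose]; exact Matrix.mem_unitaryGroup_iff.1 hU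
  have hext : ∀ u : Fin nh → ℂ, ∀ i,
      (Uᴴ.submatrix Sum.inl Sum.inr *ᵥ u) i = (Uᴴ *ᵥ Sum.elim (fun _ => 0) u) (Sum.inl i) := by
    intro u i
    simp [Matrix.mulVec, dotProduct, Fintype.sum_sum_type]
  -- The block of `Uᴴ` from the `h` labels to the `g` labels. Equality of total weights comes from
  -- unitarity, and the position bound is the operator inequality tested on vectors supported on the
  -- `h` labels.
  refine ⟨?_, Uᴴ.submatrix Sum.inl Sum.inr, ?_, fun u => ?_, fun u => ?_⟩
  · have := normSq_mulVec_of_isometry hUU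
      (Sum.elim (fun i => ((√(pg i : ℝ) : ℝ) : ℂ)) (fun _ => 0))
    rw [hvw] at this
    simp only [normSq, Fintype.sum_sum_type, Sum.elim_inl, Sum.elim_inr, Complex.norm_real,
      Real.norm_eq_abs, sq_abs, Real.sq_sqrt (NNReal.coe_nonneg _), norm_zero] at this
    simp at this
    exact_mod_cast this.symm
  · ext i
    rw [hext, ← hvw, Matrix.mulVec_mulVec, hUU, Matrix.one_mulVec]
    rfl
  · have := normSq_mulVec_of_isometry hUU' (Sum.elim (fun _ => 0) u)
    simp only [normSq, Fintype.sum_sum_type, Sum.elim_inl, Sum.elim_inr] at this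
    simp only [hext]
    have h2 : 0 ≤ ∑ j, ‖(Uᴴ *ᵥ Sum.elim (fun _ => 0) u) (Sum.inr j)‖ ^ 2 := by positivity
    simp at this
    linarith
  · have hle := LoewnerGE.expect_le hX (Sum.elim (fun _ => 0) u)
    have hE : (∑ i : Fin nh, Matrix.single (Sum.inr i : Fin ng ⊕ Fin nh) (Sum.inr i) (1 : ℂ)) =
        Matrix.diagonal (Sum.elim (fun _ => 0) (fun _ => 1)) := by
      rw [← sum_smul_single_eq_diagonal Sum.inr Sum.inr_injective (fun _ => 1)]
      · simp
      · simp
      · rintro (k | k) hk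
        · rfl
        · exact absurd ⟨k, rfl⟩ hk
    rw [hE] at hle
    set E : Matrix (Fin ng ⊕ Fin nh) (Fin ng ⊕ Fin nh) ℂ :=
      Matrix.diagonal (Sum.elim (fun _ => 0) (fun _ => 1)) with hEdef
    have hEH : Eᴴ = E := by
      rw [hEdef, Matrix.diagonal_conjTranspose]
      congr 1
      ext (i | i) <;> simp
    have hEu : E *ᵥ Sum.elim (fun _ => 0) u = Sum.elim (fun _ => 0) u := by
      ext (i | i) <;> simp [hEdef, Matrix.mulVec_diagonal]
    -- The right-hand side of the constraint is the diagonal of `g` positions conjugated by `Uᴴ E`;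
    -- its expectation at a vector fixed by `E` is the weighted norm of the `g` part of `Uᴴ u`.
    have h1 : (∑ i, ((xg i : ℝ) : ℂ) •
        (E * U * Matrix.single (Sum.inl i) (Sum.inl i) (1 : ℂ) * Uᴴ * E)) =
        (Uᴴ * E)ᴴ * Matrix.diagonal
          (fun k => ((Sum.elim (fun i => (xg i : ℝ)) (fun _ => 0) k : ℝ) : ℂ)) * (Uᴴ * E) := by
      rw [← sum_smul_single_eq_diagonal Sum.inl Sum.inl_injective (fun i => ((xg i : ℝ) : ℂ)),
        Finset.mul_sum, Finset.sum_mul]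
      · refine Finset.sum_congr rfl fun i _ => ?_
        rw [Matrix.conjTranspose_mul, Matrix.conjTranspose_conjTranspose, hEH, Matrix.mul_smul,
          Matrix.smul_mul]
        simp only [Matrix.mul_assoc]
      · simp
      · rintro (k | k) hk
        · exact absurd ⟨k, rfl⟩ hk
        · simp
    have h2 : (∑ i, ((xh i : ℝ) : ℂ) • Matrix.single (Sum.inr i : Fin ng ⊕ Fin nh) (Sum.inr i) (1 : ℂ))
        = Matrix.diagonal (fun k => ((Sum.elim (fun _ => 0) (fun i => (xh i : ℝ)) k : ℝ) : ℂ)) := by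
      rw [← sum_smul_single_eq_diagonal Sum.inr Sum.inr_injective]
      · simp
      · rintro (k | k) hk
        · simp
        · exact absurd ⟨k, rfl⟩ hk
    rw [h1, h2, expect_conj, expect_diagonal, expect_diagonal, ← Matrix.mulVec_mulVec, hEu] at hle
    simp only [Fintype.sum_sum_type, Sum.elim_inl, Sum.elim_inr, zero_mul, Finset.sum_const_zero,
      add_zero, zero_add] at hle
    simpa only [hext] using hle

/-- A line transition satisfying the TEF constraint, with coinciding points merged. -/
theorem TEFLine.dominates {σ : Type} [Fintype σ] {c : σ → ℝ≥0} (hc : Function.Injective c)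
    {g h : ℝ≥0 → ℝ≥0} (hgh : TEFLine g h) (hg : ∀ z, g z ≠ 0 → ∃ s, c s = z)
    (hh : ∀ z, h z ≠ 0 → ∃ s, c s = z) :
    Dominates c (fun s => g (c s)) c (fun s => h (c s)) := by
  obtain ⟨nk, ng, nh, xk, pk, xg, pg, xh, ph, -, -, -, hgl, hhl, U, hU⟩ := hgh
  have hg' : g = familyPoints (Sum.elim xg xk) (Sum.elim pg pk) := by
    ext z
    simp [hgl, familyPoints, linePoints, Fintype.sum_sum_type, add_comm]
  have hh' : h = familyPoints (Sum.elim xh xk) (Sum.elim ph pk) := by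
    ext z
    simp [hhl, familyPoints, linePoints, Fintype.sum_sum_type]
  have hm := hU.dominates.sumElim xk pk
  rw [hg'] at hg ⊢
  rw [hh'] at hh ⊢
  -- The matrices act from right to left: split the points of `h`, apply the contraction, merge into
  -- the points of `g`.
  exact (dominates_merge hc hg).trans (hm.trans (dominates_split hc hh))

/-! ### Completing contractions and extending isometries to unitaries -/

theorem posSemidef_of_expect_nonneg {ι : Type} [Fintype ι] {M : Matrix ι ι ℂ} (hM : M.IsHermitian)
    (h : ∀ u, 0 ≤ expect M u) : M.PosSemidef := by
  refine Matrix.PosSemidef.of_dotProduct_mulVec_nonneg hM fun u => ?_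
  refine Complex.le_def.2 ⟨h u, ?_⟩
  exact (hM.im_star_dotProduct_mulVec_self u).symm

open scoped MatrixOrder in
theorem exists_conjTranspose_mul_self {ι : Type} [Fintype ι] [DecidableEq ι] {M : Matrix ι ι ℂ}
    (hM : M.PosSemidef) : ∃ D : Matrix ι ι ℂ, M = Dᴴ * D :=
  CStarAlgebra.nonneg_iff_eq_star_mul_self.1 hM.nonneg

theorem expect_one {ι : Type} [Fintype ι] [DecidableEq ι] (u : ι → ℂ) :
    expect 1 u = normSq u := by
  simpa [normSq] using expect_diagonal (fun _ => 1) u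

/-- For a contraction, `1 - Kᴴ K` is positive semidefinite and so has the form `Dᴴ D`. -/
theorem exists_complement {ι : Type} [Fintype ι] [DecidableEq ι] {K : Matrix ι ι ℂ}
    (hK : ∀ u, normSq (K *ᵥ u) ≤ normSq u) : ∃ D : Matrix ι ι ℂ, Kᴴ * K + Dᴴ * D = 1 := by
  have h : ((1 : Matrix ι ι ℂ) - Kᴴ * K).PosSemidef := by
    refine posSemidef_of_expect_nonneg
      (Matrix.isHermitian_one.sub (Matrix.isHermitian_conjTranspose_mul_self K)) fun u => ?_
    have := expect_conj 1 K u
    rw [Matrix.mul_one] at this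
    rw [expect_sub, this, expect_one, expect_one]
    linarith [hK u]
  obtain ⟨D, hD⟩ := exists_conjTranspose_mul_self h
  exact ⟨D, by rw [← hD]; abel⟩

/-- Two isometries with the same domain differ by a unitary on the codomain. -/
theorem exists_unitary_mul_eq {ι κ : Type} [Fintype ι] [Fintype κ] [DecidableEq ι] [DecidableEq κ]
    {J V : Matrix ι κ ℂ} (hJ : Jᴴ * J = 1) (hV : Vᴴ * V = 1) :
    ∃ U ∈ Matrix.unitaryGroup ι ℂ, U * J = V := by
  have hiso : ∀ {W : Matrix ι κ ℂ}, Wᴴ * W = 1 → ∀ u, ‖Matrix.toEuclideanLin W u‖ = ‖u‖ := by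
    intro W hW u
    rw [← sq_eq_sq₀ (norm_nonneg _) (norm_nonneg _), EuclideanSpace.norm_sq_eq,
      EuclideanSpace.norm_sq_eq]
    exact normSq_mulVec_of_isometry hW u.ofLp
  let iJ : EuclideanSpace ℂ κ →ₗᵢ[ℂ] EuclideanSpace ℂ ι := ⟨Matrix.toEuclideanLin J, hiso hJ⟩
  let iV : EuclideanSpace ℂ κ →ₗᵢ[ℂ] EuclideanSpace ℂ ι := ⟨Matrix.toEuclideanLin V, hiso hV⟩
  -- The isometry from the range of `J` to the range of `V`, extended to the whole space; this is
  -- possible because domain and codomain have the same finite dimension.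
  let W := (iV.comp iJ.equivRange.symm.toLinearIsometry).extend
  have hW : ∀ u, W (iJ u) = iV u := by
    intro u
    have := LinearIsometry.extend_apply (iV.comp iJ.equivRange.symm.toLinearIsometry)
      (iJ.equivRange u)
    simpa using this
  let U : Matrix ι ι ℂ := Matrix.toEuclideanLin.symm W.toLinearMap
  have hU : ∀ u : ι → ℂ, U *ᵥ u = (W (WithLp.toLp 2 u)).ofLp := by
    intro u
    have : Matrix.toEuclideanLin U = W.toLinearMap := LinearEquiv.apply_symm_apply _ _
    have h2 := congrArg (fun f => (f (WithLp.toLp 2 u)).ofLp) this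
    exact h2
  refine ⟨U, ?_, ?_⟩
  · rw [Matrix.mem_unitaryGroup_iff']
    ext i j
    have h1 : (Uᴴ * U) i j = star (U *ᵥ Pi.single i 1) ⬝ᵥ (U *ᵥ Pi.single j 1) := by
      simp [Matrix.mul_apply, dotProduct]
    have h2 := W.inner_map_map (WithLp.toLp 2 (Pi.single i (1 : ℂ)))
      (WithLp.toLp 2 (Pi.single j (1 : ℂ)))
    rw [EuclideanSpace.inner_eq_star_dotProduct, EuclideanSpace.inner_eq_star_dotProduct] at h2
    rw [Matrix.star_eq_conjTranspose, h1, hU, hU, dotProduct_comm, h2]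
    simp [Matrix.one_apply, Pi.single_apply]
  · apply Matrix.mulVec_injective
    ext1 u
    rw [← Matrix.mulVec_mulVec, hU]
    exact congrArg (fun f => f.ofLp) (hW (WithLp.toLp 2 u))

/-! ### One message: unitary, check and dual feasibility -/

section step
variable {S T : Type} [Fintype S] [Fintype T] [DecidableEq S] [DecidableEq T]

/-- The isometry `|s, t⟩ ↦ |s⟩|s, t⟩` onto the states in which a party's register agrees with the
message. -/
def matchIso (S T : Type) [DecidableEq S] [DecidableEq T] : Matrix (Option S × (S × T)) (S × T) ℂ :=
  fun p q => if p = (some q.1, q) then 1 else 0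

/-- The isometry `|s, t⟩ ↦ ∑ s', K t s' s |s'⟩|s', t⟩ + ∑ s', D t s' s |none⟩|s', t⟩`. -/
def dilation (K D : T → Matrix S S ℂ) : Matrix (Option S × (S × T)) (S × T) ℂ :=
  fun p q => if p.2.2 = q.2 then
    p.1.elim (D q.2 p.2.1 q.1) (fun s => if s = p.2.1 then K q.2 p.2.1 q.1 else 0) else 0

theorem matchIso_isometry : (matchIso S T)ᴴ * matchIso S T = 1 := by
  ext p q
  simp only [Matrix.mul_apply, Matrix.conjTranspose_apply, matchIso, Matrix.one_apply]
  rw [Finset.sum_eq_single (some q.1, q)]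
  · by_cases h : p = q
    · simp [h]
    · have : ¬ q = p := fun e => h e.symm
      simp [h, this]
  · intro b _ hb; simp [hb]
  · simp

theorem matchIso_conjTranspose_mulVec (v : Option S × (S × T) → ℂ) (q : S × T) :
    ((matchIso S T)ᴴ *ᵥ v) q = v (some q.1, q) := by
  simp only [Matrix.mulVec, dotProduct, Matrix.conjTranspose_apply, matchIso]
  rw [Finset.sum_eq_single (some q.1, q)]
  · simp
  · intro b _ hb; simp [hb]
  · simp

theorem dilation_mulVec (K D : T → Matrix S S ℂ) (u : S × T → ℂ) (p : Option S × (S × T)) :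
    (dilation K D *ᵥ u) p = p.1.elim ((D p.2.2 *ᵥ fun s => u (s, p.2.2)) p.2.1)
      (fun s => if s = p.2.1 then (K p.2.2 *ᵥ fun s => u (s, p.2.2)) p.2.1 else 0) := by
  obtain ⟨o, s₁, t₁⟩ := p
  simp only [Matrix.mulVec, dotProduct, dilation, Fintype.sum_prod_type, ite_mul, zero_mul,
    Finset.sum_ite_eq, Finset.mem_univ, if_true]
  cases o with
  | none => rfl
  | some s => by_cases h : s = s₁ <;> simp [h]

/-- The `K` and `D` parts have orthogonal register labels, and different `t` stay orthogonal, so the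
Gram matrix is `(K t)ᴴ K t + (D t)ᴴ D t` in each block. -/
theorem dilation_isometry {K D : T → Matrix S S ℂ} (h : ∀ t, (K t)ᴴ * K t + (D t)ᴴ * D t = 1) :
    (dilation K D)ᴴ * dilation K D = 1 := by
  ext ⟨s, t⟩ ⟨s', t'⟩
  have h1 : ∀ o : Option S, ∀ s₁ t₁,
      (dilation K D)ᴴ (s, t) (o, (s₁, t₁)) * dilation K D (o, (s₁, t₁)) (s', t') =
      if t₁ = t then (if t = t' then
        o.elim (star (D t s₁ s) * D t s₁ s')
          (fun r => if r = s₁ then star (K t s₁ s) * K t s₁ s' else 0) else 0) else 0 := by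
    intro o s₁ t₁
    simp only [Matrix.conjTranspose_apply, dilation]
    by_cases ht : t₁ = t
    · by_cases ht' : t = t'
      · subst ht; subst ht'
        cases o with
        | none => simp
        | some r => by_cases hr : r = s₁ <;> simp [hr]
      · subst ht; simp [ht']
    · simp [ht]
  simp only [Matrix.mul_apply, Fintype.sum_prod_type, h1, Finset.sum_ite_eq', Finset.mem_univ,
    if_true, Fintype.sum_option, Option.elim]
  by_cases ht : t = t'
  · subst ht
    have := congrFun (congrFun (h t) s) s'
    simp only [Matrix.add_apply, Matrix.mul_apply, Matrix.conjTranspose_apply] at this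
    simp only [if_true, Finset.sum_ite_eq, Finset.mem_univ, Matrix.one_apply, Prod.mk.injEq,
      and_true]
    rw [add_comm, this, Matrix.one_apply]
  · simp [ht]

/-- The states of a party's register and the message when the other party holds `t`. -/
def slice (t : T) (f : S → ℂ) : Option S × (S × T) → ℂ :=
  fun p => if p.1 = some p.2.1 ∧ p.2.2 = t then f p.2.1 else 0

omit [Fintype S] [Fintype T] in
theorem slice_some (t : T) (f : S → ℂ) (s : S) (t' : T) :
    slice t f (some s, (s, t')) = if t' = t then f s else 0 := by
  simp [slice]

theorem matchIso_mulVec_slice (t : T) (f : S → ℂ) :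
    matchIso S T *ᵥ ((matchIso S T)ᴴ *ᵥ slice t f) = slice t f := by
  ext ⟨o, s, t'⟩
  have : ∀ v : S × T → ℂ, (matchIso S T *ᵥ v) (o, (s, t')) = if o = some s then v (s, t') else 0 := by
    intro v
    simp only [Matrix.mulVec, dotProduct, matchIso]
    rw [Finset.sum_eq_single (s, t')]
    · simp
    · rintro b _ hb
      have : ¬ (s, t') = b := fun e => hb e.symm
      simp [this]
    · simp
  rw [this, matchIso_conjTranspose_mulVec]
  by_cases h : o = some s <;> simp [slice, h]

theorem expect_diagonal_kronecker_one (d : Option S → ℝ) (v : Option S × (S × T) → ℂ) :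
    expect ((Matrix.diagonal fun o => (d o : ℂ)) ⊗ₖ (1 : Matrix (S × T) (S × T) ℂ)) v =
      ∑ o, ∑ q, d o * ‖v (o, q)‖ ^ 2 := by
  have h : (Matrix.diagonal fun o => (d o : ℂ)) ⊗ₖ (1 : Matrix (S × T) (S × T) ℂ) =
      Matrix.diagonal fun p : Option S × (S × T) => ((d p.1 : ℝ) : ℂ) := by
    rw [← Matrix.diagonal_one, Matrix.diagonal_kronecker_diagonal]
    simp
  rw [h, expect_diagonal, Fintype.sum_prod_type]

/-- One message: if for every value `t` of the other party's label the points `(c, h t)` can be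
carried to `(c, g t)`, then a unitary and a projector acting on the register and the message do it,
and the diagonal dual variables are feasible for this message. -/
theorem exists_step (c : S → ℝ≥0) (g h : T → S → ℝ≥0) (hgh : ∀ t, Dominates c (g t) c (h t)) :
    ∃ U E : Matrix (Option S × (S × T)) (Option S × (S × T)) ℂ,
      U ∈ Matrix.unitaryGroup (Option S × (S × T)) ℂ ∧ IsStarProjection E ∧
      (∀ t, U *ᵥ slice t (fun s => ((√(h t s : ℝ) : ℝ) : ℂ)) =
        slice t (fun s => ((√(g t s : ℝ) : ℝ) : ℂ))) ∧
      (∀ t, E *ᵥ slice t (fun s => ((√(g t s : ℝ) : ℝ) : ℂ)) =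
        slice t (fun s => ((√(g t s : ℝ) : ℝ) : ℂ))) ∧
      ∀ d e : Option S → ℝ, d none = 0 → (∀ s, d (some s) ≤ c s) → (∀ s, (c s : ℝ) = e (some s)) →
        0 ≤ e none →
        LoewnerGE ((Matrix.diagonal fun o => (e o : ℂ)) ⊗ₖ (1 : Matrix (S × T) (S × T) ℂ))
          (Uᴴ * E * ((Matrix.diagonal fun o => (d o : ℂ)) ⊗ₖ (1 : Matrix (S × T) (S × T) ℂ)) *
            E * U) := by
  choose hsum K hK hKc hKx using hgh
  choose D hD using fun t => exists_complement (hKc t)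
  set V := dilation K D with hVdef
  set J := matchIso S T with hJdef
  have hV : Vᴴ * V = 1 := dilation_isometry hD
  have hJ : Jᴴ * J = 1 := matchIso_isometry
  obtain ⟨U, hU, hUJ⟩ := exists_unitary_mul_eq hJ hV
  have hUU : Uᴴ * U = 1 := Matrix.mem_unitaryGroup_iff'.1 hU
  -- As `V = U J`, we have `Vᴴ U = Jᴴ`: a passed check projects the input onto states whose register
  -- agrees with the message. The action of `U` off that subspace never matters.
  have hEU : V * Vᴴ * U = V * Jᴴ := by
    rw [← hUJ, Matrix.conjTranspose_mul, Matrix.mul_assoc (U * J), Matrix.mul_assoc Jᴴ, hUU,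
      Matrix.mul_one]
  have hUE : Uᴴ * (V * Vᴴ) = (V * Jᴴ)ᴴ := by
    rw [← hEU, Matrix.conjTranspose_mul, Matrix.conjTranspose_mul, Matrix.conjTranspose_conjTranspose]
  have hstep : ∀ t, V *ᵥ (Jᴴ *ᵥ slice t (fun s => ((√(h t s : ℝ) : ℝ) : ℂ))) =
      slice t (fun s => ((√(g t s : ℝ) : ℝ) : ℂ)) := by
    intro t
    -- The completion identity at the honest amplitudes: `K t` already accounts for the full norm
    -- because the total weights agree, leaving none for `D t`.
    have hD0 : D t *ᵥ (fun s => ((√(h t s : ℝ) : ℝ) : ℂ)) = 0 := by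
      have h1 := congrArg (fun M => expect M (fun s => ((√(h t s : ℝ) : ℝ) : ℂ))) (hD t)
      have h2 : expect ((K t)ᴴ * 1 * K t + (D t)ᴴ * 1 * D t) (fun s => ((√(h t s : ℝ) : ℝ) : ℂ)) =
          expect 1 (fun s => ((√(h t s : ℝ) : ℝ) : ℂ)) := by simpa using h1
      have h3 : ∀ (M N : Matrix S S ℂ) (u : S → ℂ), expect (M + N) u = expect M u + expect N u := by
        intro M N u; simp [expect, Matrix.add_mulVec]
      rw [h3, expect_conj, expect_conj, hK, expect_one, expect_one, expect_one] at h2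
      have h4 : ∀ f : S → ℝ≥0, normSq (fun s => ((√(f s : ℝ) : ℝ) : ℂ)) = ((∑ s, f s : ℝ≥0) : ℝ) := by
        intro f
        simp [normSq]
      rw [h4, h4, hsum, add_eq_left] at h2
      funext s
      have h5 := (Finset.sum_eq_zero_iff_of_nonneg (fun _ _ => sq_nonneg _)).1 h2 s (Finset.mem_univ s)
      simpa using h5
    have h0 : ∀ t', (fun s => (Jᴴ *ᵥ slice t (fun s => ((√(h t s : ℝ) : ℝ) : ℂ))) (s, t')) =
        if t' = t then (fun s => ((√(h t s : ℝ) : ℝ) : ℂ)) else 0 := by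
      intro t'
      funext s
      rw [hJdef, matchIso_conjTranspose_mulVec, slice_some]
      split_ifs <;> rfl
    ext ⟨o, s, t'⟩
    rw [hVdef, dilation_mulVec]
    simp only [h0]
    by_cases ht : t' = t
    · subst ht
      cases o with
      | none => simp [hD0, slice]
      | some r => simp [hK, slice]
    · cases o with
      | none => simp [slice, ht]
      | some r => simp [slice, ht]
  have hUstep : ∀ t, U *ᵥ slice t (fun s => ((√(h t s : ℝ) : ℝ) : ℂ)) =
        slice t (fun s => ((√(g t s : ℝ) : ℝ) : ℂ)) := by
    intro t
    rw [← hstep, ← hUJ, ← Matrix.mulVec_mulVec, hJdef, matchIso_mulVec_slice]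
  have hE : IsStarProjection (V * Vᴴ) := by
    refine ⟨?_, ?_⟩
    · rw [IsIdempotentElem, Matrix.mul_assoc, ← Matrix.mul_assoc Vᴴ, hV, Matrix.one_mul]
    · exact Matrix.isHermitian_mul_conjTranspose_self V
  refine ⟨U, V * Vᴴ, hU, hE, hUstep, fun t => ?_, fun d e hd hdc hec he => ?_⟩
  · conv_lhs => rw [← hUstep, Matrix.mulVec_mulVec, hEU, ← Matrix.mulVec_mulVec, hstep]
  · have hre : Uᴴ * (V * Vᴴ) * ((Matrix.diagonal fun o => (d o : ℂ)) ⊗ₖ (1 : Matrix (S × T) (S × T) ℂ))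
        * (V * Vᴴ) * U = (V * Jᴴ)ᴴ *
        ((Matrix.diagonal fun o => (d o : ℂ)) ⊗ₖ (1 : Matrix (S × T) (S × T) ℂ)) * (V * Jᴴ) := by
      rw [Matrix.mul_assoc _ (V * Vᴴ) U, hEU, hUE]
    have hherm : ∀ d : Option S → ℝ,
        ((Matrix.diagonal fun o => (d o : ℂ)) ⊗ₖ (1 : Matrix (S × T) (S × T) ℂ)).IsHermitian := by
      intro d
      refine Matrix.IsHermitian.ext fun p q => ?_
      by_cases h1 : p.1 = q.1 <;> by_cases h2 : p.2 = q.2 <;>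
        simp [Matrix.kroneckerMap_apply, Matrix.one_apply, h1, h2, eq_comm]
    rw [hre]
    refine posSemidef_of_expect_nonneg
      ((hherm e).sub (Matrix.isHermitian_conjTranspose_mul_mul _ (hherm d))) fun v => ?_
    rw [expect_sub, expect_conj, expect_diagonal_kronecker_one, expect_diagonal_kronecker_one,
      sub_nonneg, ← Matrix.mulVec_mulVec]
    simp only [hVdef, dilation_mulVec, hJdef, matchIso_conjTranspose_mulVec, Fintype.sum_option,
      Option.elim, hd, zero_mul, Finset.sum_const_zero, zero_add, ← hec]
    -- On the left the `none` branch costs nothing since `d none = 0`; on the right its contribution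
    -- is nonnegative and is dropped.
    refine le_trans ?_ (le_add_of_nonneg_left
      (Finset.sum_nonneg fun q _ => mul_nonneg he (sq_nonneg _)))
    calc _ = ∑ s, ∑ t, d (some s) * ‖(K t *ᵥ fun s => v (some s, (s, t))) s‖ ^ 2 := by
          refine Finset.sum_congr rfl fun s _ => ?_
          simp only [Fintype.sum_prod_type_right, apply_ite norm, norm_zero, ite_pow]
          simp
      _ = ∑ t, ∑ s, d (some s) * ‖(K t *ᵥ fun s => v (some s, (s, t))) s‖ ^ 2 := Finset.sum_comm
      _ ≤ ∑ t, ∑ s, (c s : ℝ) * ‖(K t *ᵥ fun s => v (some s, (s, t))) s‖ ^ 2 := by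
          gcongr with t _ s
          exact hdc s
      _ ≤ ∑ t, ∑ s, (c s : ℝ) * ‖v (some s, (s, t))‖ ^ 2 :=
          Finset.sum_le_sum fun t _ => hKx t _
      _ = ∑ s, ∑ t, (c s : ℝ) * ‖v (some s, (s, t))‖ ^ 2 := Finset.sum_comm
      -- The entries whose register agrees with the message are among all entries of the state.
      _ ≤ _ := by
          refine Finset.sum_le_sum fun s _ => ?_
          rw [Fintype.sum_prod_type_right]
          refine Finset.sum_le_sum fun t _ => ?_
          exact Finset.single_le_sum (f := fun s' => (c s : ℝ) * ‖v (some s, (s', t))‖ ^ 2)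
            (fun _ _ => by positivity) (Finset.mem_univ s)

end step

/-! ### Eigenprojectors of diagonal certificates and the states of frames -/

theorem eigProj_diagonal {ι : Type} [Fintype ι] [DecidableEq ι] (d : ι → ℝ) (z : ℝ) :
    eigProj (Matrix.diagonal fun i => (d i : ℂ)) z =
      Matrix.diagonal fun i => (((if d i = z then 1 else 0 : ℝ)) : ℂ) := by
  rw [eigProj]
  rw [← (Matrix.toEuclideanCLM (n := ι) (𝕜 := ℂ)).symm_apply_apply
    (Matrix.diagonal fun i => (((if d i = z then 1 else 0 : ℝ)) : ℂ))]
  congr 1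
  have hmem : ∀ w : EuclideanSpace ℂ ι, w ∈ Module.End.eigenspace
      (Matrix.toEuclideanLin (Matrix.diagonal fun i => (d i : ℂ))) (z : ℂ) ↔
      ∀ i, (d i : ℂ) * w i = z * w i := by
    intro w
    rw [Module.End.mem_eigenspace_iff]
    constructor
    · intro h i
      have := congrArg (fun f => f.ofLp i) h
      simpa [Matrix.mulVec_diagonal] using this
    · intro h
      ext i
      simpa [Matrix.mulVec_diagonal] using h i
  ext1 u
  -- The masked vector is the projection of `u`: it lies in the eigenspace, and the residual is
  -- supported where every eigenvector vanishes.
  refine Submodule.eq_starProjection_of_mem_of_inner_eq_zero ?_ ?_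
  · rw [hmem]
    intro i
    by_cases h : d i = z <;> simp [Matrix.mulVec_diagonal, h]
  · intro w hw
    rw [hmem] at hw
    rw [EuclideanSpace.inner_eq_star_dotProduct]
    refine Finset.sum_eq_zero fun i _ => ?_
    by_cases h : d i = z
    · simp [Matrix.mulVec_diagonal, h]
    · have h2 : w i = 0 := by
        have h3 := sub_eq_zero.2 (hw i)
        rw [← sub_mul, ← Complex.ofReal_sub] at h3
        exact (mul_eq_zero.1 h3).resolve_left (Complex.ofReal_ne_zero.2 (sub_ne_zero.2 h))
      simp [h2]

section state
variable {S T : Type} [Fintype S] [Fintype T] [DecidableEq S] [DecidableEq T]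

/-- The state `∑ √(f s t) |s⟩|s, t⟩|t⟩`. -/
noncomputable def gameState (f : S → T → ℝ≥0) : Option S × (S × T) × Option T → ℂ :=
  fun p => if p.1 = some p.2.1.1 ∧ p.2.2 = some p.2.1.2 then
    ((√(f p.2.1.1 p.2.1.2 : ℝ) : ℝ) : ℂ) else 0

omit [Fintype S] [Fintype T] in
theorem kronecker_diagonal (w₁ : Option S → ℝ) (w₂ : Option T → ℝ) :
    (Matrix.diagonal fun o => (w₁ o : ℂ)) ⊗ₖ ((1 : Matrix (S × T) (S × T) ℂ) ⊗ₖ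
      Matrix.diagonal fun o => (w₂ o : ℂ)) =
    Matrix.diagonal fun p : Option S × (S × T) × Option T => ((w₁ p.1 * w₂ p.2.2 : ℝ) : ℂ) := by
  rw [← Matrix.diagonal_one, Matrix.diagonal_kronecker_diagonal, Matrix.diagonal_kronecker_diagonal]
  simp

theorem sum_gameState (f : S → T → ℝ≥0) (w : Option S → Option T → ℝ) :
    ∑ p : Option S × (S × T) × Option T, w p.1 p.2.2 * ‖gameState f p‖ ^ 2 =
      ∑ s, ∑ t, w (some s) (some t) * f s t := by
  simp only [Fintype.sum_prod_type, gameState]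
  rw [Finset.sum_comm]
  refine Finset.sum_congr rfl fun s _ => ?_
  rw [Finset.sum_comm]
  refine Finset.sum_congr rfl fun t _ => ?_
  rw [Finset.sum_eq_single (some s), Finset.sum_eq_single (some t)]
  · simp
  · intro o _ ho; simp [ho]
  · simp
  · intro o _ ho; simp [ho]
  · simp

theorem prob_gameState (f : S → T → ℝ≥0) (dA : Option S → ℝ) (dB : Option T → ℝ)
    (z : ℝ≥0 × ℝ≥0) :
    prob (Matrix.diagonal fun o => (dA o : ℂ)) (Matrix.diagonal fun o => (dB o : ℂ))
      (gameState f) z =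
    ∑ s, ∑ t, (if dA (some s) = z.1 then 1 else 0) * (if dB (some t) = z.2 then 1 else 0) *
      (f s t : ℝ) := by
  rw [prob, eigProj_diagonal, eigProj_diagonal, kronecker_diagonal, expect_diagonal,
    sum_gameState f (fun a b => (if dA a = z.1 then 1 else 0) * (if dB b = z.2 then 1 else 0))]

omit [Fintype S] [Fintype T] in
-- A one-point frame gives a product state; this makes the final frame an admissible starting state
-- of the protocol.
theorem gameState_single (s : S) (t : T) (f : S → T → ℝ≥0)
    (hf : ∀ s' t', f s' t' = if s' = s ∧ t' = t then 1 else 0) :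
    gameState f = fun p => (Pi.single (some s) 1 : Option S → ℂ) p.1 *
      (Pi.single (s, t) 1 : S × T → ℂ) p.2.1 * (Pi.single (some t) 1 : Option T → ℂ) p.2.2 := by
  ext ⟨a, ⟨s', t'⟩, b⟩
  simp only [gameState, hf, Pi.single_apply, Prod.mk.injEq]
  by_cases hs : s' = s
  · by_cases ht : t' = t
    · subst hs; subst ht
      by_cases ha : a = some s' <;> by_cases hb : b = some t' <;> simp [ha, hb]
    · simp [ht]
  · simp [hs]

end state

/-! ### Local operators on the joint space and weak duality -/

theorem liftA_mulVec {a m b : Type} [Fintype a] [Fintype m] [Fintype b] [DecidableEq b]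
    (X : Matrix (a × m) (a × m) ℂ) (v : a × m × b → ℂ) (i : a) (j : m) (k : b) :
    (liftA X *ᵥ v) (i, j, k) = (X *ᵥ fun p => v (p.1, p.2, k)) (i, j) := by
  simp [Matrix.mulVec, dotProduct, liftA, Fintype.sum_prod_type, Matrix.kroneckerMap_apply,
    Matrix.one_apply]

theorem liftB_mulVec {a m b : Type} [Fintype a] [Fintype m] [Fintype b] [DecidableEq a]
    (X : Matrix (m × b) (m × b) ℂ) (v : a × m × b → ℂ) (i : a) (q : m × b) :
    (liftB X *ᵥ v) (i, q) = (X *ᵥ fun p => v (i, p)) q := by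
  simp only [Matrix.mulVec, dotProduct, liftB, Fintype.sum_prod_type (α₁ := a),
    Matrix.kroneckerMap_apply, Matrix.one_apply, ite_mul, one_mul, zero_mul]
  rw [Finset.sum_eq_single i] <;> simp +contextual [eq_comm]

section duality
variable {a m b : Type} [Fintype a] [Fintype m] [Fintype b]
  [DecidableEq a] [DecidableEq m] [DecidableEq b]

omit [Fintype a] [Fintype m] [Fintype b] [DecidableEq a] in
theorem liftA_kronecker_one (Z : Matrix a a ℂ) :
    liftA (b := b) (Z ⊗ₖ (1 : Matrix m m ℂ)) = Z ⊗ₖ (1 : Matrix (m × b) (m × b) ℂ) := by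
  rw [liftA, Matrix.kronecker_assoc, Matrix.one_kronecker_one]

omit [DecidableEq a] [DecidableEq m] in
theorem expect_liftA (X : Matrix (a × m) (a × m) ℂ) (v : a × m × b → ℂ) :
    expect (liftA X) v = ∑ k, expect X (fun p => v (p.1, p.2, k)) := by
  simp only [expect, dotProduct, ← Complex.re_sum]
  congr 1
  rw [Finset.sum_comm, Fintype.sum_prod_type, Fintype.sum_prod_type]
  refine Finset.sum_congr rfl fun i _ => ?_
  rw [Fintype.sum_prod_type]
  refine Finset.sum_congr rfl fun j _ => Finset.sum_congr rfl fun k _ => ?_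
  rw [liftA_mulVec]
  rfl

omit [DecidableEq m] [DecidableEq b] in
theorem expect_liftB (X : Matrix (m × b) (m × b) ℂ) (v : a × m × b → ℂ) :
    expect (liftB X) v = ∑ i, expect X (fun p => v (i, p)) := by
  simp only [expect, dotProduct, ← Complex.re_sum]
  congr 1
  rw [Fintype.sum_prod_type]
  refine Finset.sum_congr rfl fun i _ => Finset.sum_congr rfl fun q _ => ?_
  rw [liftB_mulVec]
  rfl

omit [DecidableEq a] [DecidableEq m] in
theorem expect_liftA_conj (X Y : Matrix (a × m) (a × m) ℂ) (v : a × m × b → ℂ) :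
    expect (liftA X) (liftA Y *ᵥ v) = expect (liftA (Yᴴ * X * Y)) v := by
  simp only [expect_liftA, expect_conj]
  refine Finset.sum_congr rfl fun k _ => congrArg _ ?_
  ext p
  exact liftA_mulVec _ _ _ _ _

omit [DecidableEq m] [DecidableEq b] in
theorem expect_liftB_conj (X Y : Matrix (m × b) (m × b) ℂ) (v : a × m × b → ℂ) :
    expect (liftB X) (liftB Y *ᵥ v) = expect (liftB (Yᴴ * X * Y)) v := by
  simp only [expect_liftB, expect_conj]
  refine Finset.sum_congr rfl fun k _ => congrArg _ ?_
  ext p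
  exact liftB_mulVec _ _ _ _

theorem expect_kronecker_one_liftB (Z : Matrix a a ℂ) {V : Matrix (m × b) (m × b) ℂ}
    (hV : V ∈ Matrix.unitaryGroup (m × b) ℂ) (v : a × m × b → ℂ) :
    expect (Z ⊗ₖ (1 : Matrix (m × b) (m × b) ℂ)) (liftB V *ᵥ v) =
      expect (Z ⊗ₖ (1 : Matrix (m × b) (m × b) ℂ)) v := by
  have hVV : Vᴴ * V = 1 := Matrix.mem_unitaryGroup_iff'.1 hV
  rw [← expect_conj, liftB, Matrix.conjTranspose_kronecker, ← Matrix.mul_kronecker_mul,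
    ← Matrix.mul_kronecker_mul]
  simp [hVV]

theorem expect_one_kronecker_liftA (Z : Matrix b b ℂ) {V : Matrix (a × m) (a × m) ℂ}
    (hV : V ∈ Matrix.unitaryGroup (a × m) ℂ) (v : a × m × b → ℂ) :
    expect ((1 : Matrix a a ℂ) ⊗ₖ ((1 : Matrix m m ℂ) ⊗ₖ Z)) (liftA V *ᵥ v) =
      expect ((1 : Matrix a a ℂ) ⊗ₖ ((1 : Matrix m m ℂ) ⊗ₖ Z)) v := by
  have hVV : Vᴴ * V = 1 := Matrix.mem_unitaryGroup_iff'.1 hV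
  have h : (1 : Matrix a a ℂ) ⊗ₖ ((1 : Matrix m m ℂ) ⊗ₖ Z) =
      Matrix.reindex (Equiv.prodAssoc a m b) (Equiv.prodAssoc a m b)
        ((1 : Matrix (a × m) (a × m) ℂ) ⊗ₖ Z) := by
    rw [← Matrix.one_kronecker_one, Matrix.kronecker_assoc]
  rw [← expect_conj, liftA, h]
  simp only [Matrix.reindex_apply, Matrix.conjTranspose_submatrix, Matrix.submatrix_mul_equiv,
    Matrix.conjTranspose_kronecker, ← Matrix.mul_kronecker_mul]
  simp [hVV]

theorem expect_kronecker_product {ι κ : Type} [Fintype ι] [Fintype κ] [DecidableEq ι]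
    [DecidableEq κ] (M : Matrix ι ι ℂ) (v : ι → ℂ) (w : κ → ℂ) :
    expect (M ⊗ₖ (1 : Matrix κ κ ℂ)) (fun p => v p.1 * w p.2) = expect M v * normSq w := by
  have h : ∀ i j, ((M ⊗ₖ (1 : Matrix κ κ ℂ)) *ᵥ (fun p : ι × κ => v p.1 * w p.2)) (i, j) =
      (M *ᵥ v) i * w j := by
    intro i j
    simp only [Matrix.mulVec, dotProduct, Fintype.sum_prod_type, Matrix.kroneckerMap_apply,
      Matrix.one_apply, mul_ite, mul_one, mul_zero, ite_mul, zero_mul, Finset.sum_ite_eq,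
      Finset.mem_univ, if_true, Finset.sum_mul, mul_assoc]
  have h2 : star (fun p : ι × κ => v p.1 * w p.2) ⬝ᵥ ((M ⊗ₖ (1 : Matrix κ κ ℂ)) *ᵥ
      (fun p : ι × κ => v p.1 * w p.2)) = (star v ⬝ᵥ (M *ᵥ v)) * ((normSq w : ℝ) : ℂ) := by
    rw [ofReal_normSq]
    simp only [dotProduct, Fintype.sum_prod_type, h, Finset.sum_mul_sum, Pi.star_apply, star_mul']
    refine Finset.sum_congr rfl fun i _ => Finset.sum_congr rfl fun j _ => ?_
    ring
  rw [expect, h2, Complex.re_mul_ofReal]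
  rfl

theorem expect_product_kronecker {ι κ : Type} [Fintype ι] [Fintype κ] [DecidableEq ι]
    [DecidableEq κ] (M : Matrix κ κ ℂ) (v : ι → ℂ) (w : κ → ℂ) :
    expect ((1 : Matrix ι ι ℂ) ⊗ₖ M) (fun p => v p.1 * w p.2) = normSq v * expect M w := by
  have h : ∀ i j, (((1 : Matrix ι ι ℂ) ⊗ₖ M) *ᵥ (fun p : ι × κ => v p.1 * w p.2)) (i, j) =
      v i * (M *ᵥ w) j := by
    intro i j
    simp only [Matrix.mulVec, dotProduct, Fintype.sum_prod_type, Matrix.kroneckerMap_apply,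
      Matrix.one_apply, ite_mul, one_mul, zero_mul, Finset.mul_sum]
    rw [Finset.sum_eq_single i]
    · refine Finset.sum_congr rfl fun k _ => ?_
      simp only [if_true]
      ring
    · intro k _ hk
      simp [Ne.symm hk]
    · simp
  have h2 : star (fun p : ι × κ => v p.1 * w p.2) ⬝ᵥ (((1 : Matrix ι ι ℂ) ⊗ₖ M) *ᵥ
      (fun p : ι × κ => v p.1 * w p.2)) = ((normSq v : ℝ) : ℂ) * (star w ⬝ᵥ (M *ᵥ w)) := by
    rw [ofReal_normSq]
    simp only [dotProduct, Fintype.sum_prod_type, h, Finset.sum_mul_sum, Pi.star_apply, star_mul']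
    refine Finset.sum_congr rfl fun i _ => Finset.sum_congr rfl fun j _ => ?_
    ring
  rw [expect, h2, Complex.re_ofReal_mul]
  rfl

theorem expect_submatrix {ι κ : Type} [Fintype ι] [Fintype κ] (M : Matrix ι ι ℂ) (e : κ ≃ ι)
    (v : κ → ℂ) : expect (M.submatrix e e) v = expect M (v ∘ e.symm) := by
  rw [expect, expect, Matrix.submatrix_mulVec_equiv]
  congr 1
  simp only [dotProduct]
  rw [← Equiv.sum_comp e]
  simp

variable {P : Protocol a m b} {ZA : ℕ → Matrix a a ℂ} {ZB : ℕ → Matrix b b ℂ}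

/-- The expectation of `ZA i` never increases along the protocol. In Alice's turns this is the
feasibility inequality applied to each workspace slice; in Bob's turns his unitary does not touch
her register and her certificate is idle. The initial state is a product, which gives the bound. -/
theorem Protocol.IsDualFeasible.expect_stateBobCheats_le (hZ : P.IsDualFeasible ZA ZB) {d : ℕ}
    (χ : m × Fin d → ℂ) {V : ℕ → Matrix (m × Fin d) (m × Fin d) ℂ}
    (hV : ∀ i, V i ∈ Matrix.unitaryGroup (m × Fin d) ℂ) (i : ℕ) (hi : i ≤ P.n) :
    expect (ZA i ⊗ₖ (1 : Matrix (m × Fin d) (m × Fin d) ℂ)) (P.stateBobCheats χ V i) ≤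
      expect (ZA 0) P.ψA * normSq χ := by
  induction i with
  | zero => exact (expect_kronecker_product (ZA 0) P.ψA χ).le
  | succ i ih =>
    refine le_trans ?_ (ih (by omega))
    rw [Protocol.stateBobCheats]
    split_ifs with hodd
    · have hE := (P.EA_proj (i + 1) hi hodd).isSelfAdjoint.star_eq
      rw [Matrix.star_eq_conjTranspose] at hE
      rw [← liftA_kronecker_one, ← liftA_kronecker_one, expect_liftA_conj, expect_liftA,
        expect_liftA]
      refine Finset.sum_le_sum fun k _ => ?_
      have := LoewnerGE.expect_le (hZ.stepA i (by omega) hodd)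
        (fun p => P.stateBobCheats χ V i (p.1, p.2, k))
      rw [Matrix.conjTranspose_mul, hE]
      simpa only [Matrix.mul_assoc] using this
    · rw [expect_kronecker_one_liftB _ (hV _), hZ.idleA i (by omega) (Nat.not_odd_iff_even.1 hodd)]

theorem Protocol.IsDualFeasible.expect_stateAliceCheats_le (hZ : P.IsDualFeasible ZA ZB) {d : ℕ}
    (χ : Fin d × m → ℂ) {V : ℕ → Matrix (Fin d × m) (Fin d × m) ℂ}
    (hV : ∀ i, V i ∈ Matrix.unitaryGroup (Fin d × m) ℂ) (i : ℕ) (hi : i ≤ P.n) :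
    expect ((1 : Matrix (Fin d) (Fin d) ℂ) ⊗ₖ ((1 : Matrix m m ℂ) ⊗ₖ ZB i))
      (P.stateAliceCheats χ V i) ≤ normSq χ * expect (ZB 0) P.ψB := by
  induction i with
  | zero =>
    refine le_of_eq ?_
    rw [← expect_product_kronecker, ← Matrix.one_kronecker_one]
    have h := Matrix.kronecker_assoc (1 : Matrix (Fin d) (Fin d) ℂ) (1 : Matrix m m ℂ) (ZB 0)
    rw [← h, Matrix.reindex_apply, expect_submatrix]
    rfl
  | succ i ih =>
    refine le_trans ?_ (ih (by omega))
    rw [Protocol.stateAliceCheats]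
    split_ifs with hodd
    · rw [expect_one_kronecker_liftA _ (hV _), hZ.idleB i (by omega) hodd]
    · have heven := Nat.not_odd_iff_even.1 hodd
      have hE := (P.EB_proj (i + 1) hi heven (Nat.succ_pos i)).isSelfAdjoint.star_eq
      rw [Matrix.star_eq_conjTranspose] at hE
      have hl : ∀ X : Matrix (m × b) (m × b) ℂ, (1 : Matrix (Fin d) (Fin d) ℂ) ⊗ₖ X = liftB X :=
        fun _ => rfl
      rw [hl, hl, expect_liftB_conj, expect_liftB, expect_liftB]
      refine Finset.sum_le_sum fun k _ => ?_
      have := LoewnerGE.expect_le (hZ.stepB i (by omega) heven)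
        (fun p => P.stateAliceCheats χ V i (k, p))
      rw [Matrix.conjTranspose_mul, hE]
      simpa only [Matrix.mul_assoc] using this

/-- Weak duality: a dual feasible point bounds Bob's cheating probability. -/
theorem Protocol.IsDualFeasible.cheatB_le (hZ : P.IsDualFeasible ZA ZB) :
    P.cheatB ≤ ENNReal.ofReal (expect (ZA 0) P.ψA) := by
  refine iSup_le fun d => iSup_le fun χ => iSup_le fun hχ => iSup_le fun V => iSup_le fun hV => ?_
  refine ENNReal.ofReal_le_ofReal ?_
  have := hZ.expect_stateBobCheats_le χ hV P.n le_rfl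
  rwa [hZ.finalA, hχ, mul_one] at this

/-- Weak duality: a dual feasible point bounds Alice's cheating probability. -/
theorem Protocol.IsDualFeasible.cheatA_le (hZ : P.IsDualFeasible ZA ZB) :
    P.cheatA ≤ ENNReal.ofReal (expect (ZB 0) P.ψB) := by
  refine iSup_le fun d => iSup_le fun χ => iSup_le fun hχ => iSup_le fun V => iSup_le fun hV => ?_
  refine ENNReal.ofReal_le_ofReal ?_
  have := hZ.expect_stateAliceCheats_le χ hV P.n le_rfl
  rwa [hZ.finalB, hχ, one_mul] at this

end duality

/-! ### The message step for Alice and for Bob -/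

section party
variable {S T : Type} [Fintype S] [Fintype T] [DecidableEq S] [DecidableEq T]

omit [Fintype S] [Fintype T] [DecidableEq S] in
theorem gameState_some (f : S → T → ℝ≥0) [DecidableEq S] (t : T) :
    (fun p : Option S × (S × T) => gameState f (p.1, p.2, some t)) =
      slice t (fun s => ((√(f s t : ℝ) : ℝ) : ℂ)) := by
  ext ⟨o, s, t'⟩
  by_cases h : t' = t
  · subst h; simp [gameState, slice]
  · have : ¬ t = t' := fun e => h e.symm
    simp [gameState, slice, h, this]

/-- Alice's message for a horizontal transition. -/
theorem exists_step_alice (c : S → ℝ≥0) (g h : S → T → ℝ≥0)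
    (hgh : ∀ t, Dominates c (fun s => g s t) c (fun s => h s t)) :
    ∃ U E : Matrix (Option S × (S × T)) (Option S × (S × T)) ℂ,
      U ∈ Matrix.unitaryGroup (Option S × (S × T)) ℂ ∧ IsStarProjection E ∧
      liftA U *ᵥ gameState h = gameState g ∧ liftA E *ᵥ gameState g = gameState g ∧
      ∀ d e : Option S → ℝ, d none = 0 → (∀ s, d (some s) ≤ c s) → (∀ s, (c s : ℝ) = e (some s)) →
        0 ≤ e none →
        LoewnerGE ((Matrix.diagonal fun o => (e o : ℂ)) ⊗ₖ (1 : Matrix (S × T) (S × T) ℂ))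
          (Uᴴ * E * ((Matrix.diagonal fun o => (d o : ℂ)) ⊗ₖ (1 : Matrix (S × T) (S × T) ℂ)) *
            E * U) := by
  obtain ⟨U, E, hU, hE, hU', hE', hL⟩ := exists_step c (fun t s => g s t) (fun t s => h s t) hgh
  have hlift : ∀ (X : Matrix (Option S × (S × T)) (Option S × (S × T)) ℂ) (f f' : S → T → ℝ≥0),
      (∀ t, X *ᵥ slice t (fun s => ((√(f s t : ℝ) : ℝ) : ℂ)) =
        slice t (fun s => ((√(f' s t : ℝ) : ℝ) : ℂ))) →
      liftA X *ᵥ gameState f = gameState f' := by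
    intro X f f' hX
    ext ⟨o, q, k⟩
    rw [liftA_mulVec]
    cases k with
    | none =>
      have h0 : ∀ f : S → T → ℝ≥0, ∀ p : Option S × (S × T), gameState f (p.1, p.2, none) = 0 := by
        intro f p; simp [gameState]
      have h1 := h0 f' (o, q)
      simp only at h1
      simp only [h0, h1]
      exact congrFun (Matrix.mulVec_zero X) (o, q)
    | some t =>
      rw [gameState_some, hX, ← gameState_some]
  exact ⟨U, E, hU, hE, hlift U h g hU', hlift E g g hE', hL⟩

/-- The exchange of the two parties. -/
def swapParties (S T : Type) : (S × T) × Option T ≃ Option T × (T × S) :=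
  (Equiv.prodComm _ _).trans (Equiv.prodCongr (Equiv.refl _) (Equiv.prodComm _ _))

/-- Bob's message for a vertical transition. -/
theorem exists_step_bob (c : T → ℝ≥0) (g h : S → T → ℝ≥0)
    (hgh : ∀ s, Dominates c (g s) c (h s)) :
    ∃ U E : Matrix ((S × T) × Option T) ((S × T) × Option T) ℂ,
      U ∈ Matrix.unitaryGroup ((S × T) × Option T) ℂ ∧ IsStarProjection E ∧
      liftB U *ᵥ gameState h = gameState g ∧ liftB E *ᵥ gameState g = gameState g ∧
      ∀ d e : Option T → ℝ, d none = 0 → (∀ s, d (some s) ≤ c s) → (∀ s, (c s : ℝ) = e (some s)) →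
        0 ≤ e none →
        LoewnerGE ((1 : Matrix (S × T) (S × T) ℂ) ⊗ₖ (Matrix.diagonal fun o => (e o : ℂ)))
          (Uᴴ * E * ((1 : Matrix (S × T) (S × T) ℂ) ⊗ₖ (Matrix.diagonal fun o => (d o : ℂ))) *
            E * U) := by
  obtain ⟨U, E, hU, hE, hU', hE', hL⟩ := exists_step c g h hgh
  set e := swapParties S T with he
  have hsome : ∀ (f : S → T → ℝ≥0) (s : S),
      (fun p : (S × T) × Option T => gameState f (some s, p)) ∘ e.symm =
        slice s (fun t => ((√(f s t : ℝ) : ℝ) : ℂ)) := by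
    intro f s
    ext ⟨o, t, s'⟩
    have h1 : e.symm (o, t, s') = ((s', t), o) := rfl
    simp only [Function.comp_apply, h1]
    by_cases h : s' = s
    · subst h; simp [gameState, slice]
    · have : ¬ s = s' := fun e => h e.symm
      simp [gameState, slice, h, this]
  have hlift : ∀ (X : Matrix (Option T × (T × S)) (Option T × (T × S)) ℂ) (f f' : S → T → ℝ≥0),
      (∀ s, X *ᵥ slice s (fun t => ((√(f s t : ℝ) : ℝ) : ℂ)) =
        slice s (fun t => ((√(f' s t : ℝ) : ℝ) : ℂ))) →
      liftB (X.submatrix e e) *ᵥ gameState f = gameState f' := by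
    intro X f f' hX
    ext ⟨k, q⟩
    rw [liftB_mulVec]
    cases k with
    | none =>
      have h0 : ∀ f : S → T → ℝ≥0, ∀ p : (S × T) × Option T, gameState f (none, p) = 0 := by
        intro f p; simp [gameState]
      simp only [h0]
      exact congrFun (Matrix.mulVec_zero _) q
    | some s =>
      rw [Matrix.submatrix_mulVec_equiv, hsome, hX, ← hsome]
      simp
  refine ⟨U.submatrix e e, E.submatrix e e, ?_, ⟨?_, ?_⟩, hlift U h g hU', hlift E g g hE',
    fun d e' h1 h2 h3 h4 => ?_⟩
  · rw [Matrix.mem_unitaryGroup_iff', Matrix.star_eq_conjTranspose, Matrix.conjTranspose_submatrix,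
      Matrix.submatrix_mul_equiv, ← Matrix.star_eq_conjTranspose,
      Matrix.mem_unitaryGroup_iff'.1 hU, Matrix.submatrix_one_equiv]
  · rw [IsIdempotentElem, Matrix.submatrix_mul_equiv, hE.isIdempotentElem.eq]
  · rw [isSelfAdjoint_iff, Matrix.star_eq_conjTranspose, Matrix.conjTranspose_submatrix,
      ← Matrix.star_eq_conjTranspose, hE.isSelfAdjoint.star_eq]
  · have hk : ∀ d : Option T → ℝ,
        (1 : Matrix (S × T) (S × T) ℂ) ⊗ₖ (Matrix.diagonal fun o => (d o : ℂ)) =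
        ((Matrix.diagonal fun o => (d o : ℂ)) ⊗ₖ (1 : Matrix (T × S) (T × S) ℂ)).submatrix e e := by
      intro d
      ext ⟨⟨s, t⟩, o⟩ ⟨⟨s', t'⟩, o'⟩
      have h1 : e ((s, t), o) = (o, t, s) := rfl
      have h2 : e ((s', t'), o') = (o', t', s') := rfl
      simp [h1, h2, Matrix.kroneckerMap_apply, Matrix.one_apply, and_comm]
    have := (hL d e' h1 h2 h3 h4).submatrix e
    rw [LoewnerGE, hk, hk, Matrix.conjTranspose_submatrix]
    simpa only [Matrix.submatrix_mul_equiv, Matrix.submatrix_sub, Pi.sub_apply] using this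

end party

/-! ### Certificate values: positions and the indicator of position `1` -/

theorem diagonal_posSemidef {ι : Type} [Fintype ι] [DecidableEq ι] {d : ι → ℝ} (hd : ∀ i, 0 ≤ d i) :
    (Matrix.diagonal fun i => (d i : ℂ)).PosSemidef :=
  Matrix.PosSemidef.diagonal fun i => Complex.zero_le_real.2 (hd i)

theorem sum_mul_single {s t : Finset ℝ≥0} (φ : s → t → ℝ) (x : s) (y : t) (r : ℝ≥0) :
    ∑ i, ∑ j, φ i j * ((Finsupp.single ((x : ℝ≥0), (y : ℝ≥0)) r : Frame) ((i : ℝ≥0), (j : ℝ≥0)) : ℝ) =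
      φ x y * r := by
  rw [Finset.sum_eq_single x, Finset.sum_eq_single y]
  · simp
  · intro j _ hj
    have : ¬ (y : ℝ≥0) = j := fun h => hj (Subtype.ext h.symm)
    simp [this]
  · simp
  · intro i _ hi
    have : ¬ (x : ℝ≥0) = i := fun h => hi (Subtype.ext h.symm)
    simp [this]
  · simp

/-- The position of a label; the auxiliary label is at `0`. -/
noncomputable def position {s : Finset ℝ≥0} (o : Option s) : ℝ := o.elim 0 fun x => ((x : ℝ≥0) : ℝ)

/-- The indicator function of the label at position `1`. -/
noncomputable def atOne {s : Finset ℝ≥0} (o : Option s) : ℝ := o.elim 0 fun x => if (x : ℝ≥0) = 1 then 1 else 0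

theorem position_nonneg {s : Finset ℝ≥0} (o : Option s) : 0 ≤ position o := by
  cases o with
  | none => exact le_rfl
  | some x => exact NNReal.coe_nonneg _

theorem atOne_nonneg {s : Finset ℝ≥0} (o : Option s) : 0 ≤ atOne o := by
  cases o with
  | none => exact le_rfl
  | some x =>
    simp only [atOne, Option.elim]
    split_ifs <;> norm_num

theorem atOne_le_one {s : Finset ℝ≥0} (o : Option s) : atOne o ≤ 1 := by
  cases o with
  | none => exact zero_le_one
  | some x =>
    simp only [atOne, Option.elim]
    split_ifs <;> norm_num

/-- This lets the indicator stand in for the position as the later certificate in a feasibility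
inequality. -/
theorem atOne_le {s : Finset ℝ≥0} (x : s) : atOne (some x) ≤ ((x : ℝ≥0) : ℝ) := by
  simp only [atOne, Option.elim]
  split_ifs with h
  · simp [h]
  · exact NNReal.coe_nonneg _

/-! ### Label sets and the padded sequence of frames -/

namespace PointGame
variable (G : PointGame)

/-- The first coordinates that occur in the game. -/
noncomputable def xs : Finset ℝ≥0 :=
  (Finset.range (G.n + 1)).biUnion fun i => (G.frame i).support.image Prod.fst

/-- The second coordinates that occur in the game. -/
noncomputable def ys : Finset ℝ≥0 :=
  (Finset.range (G.n + 1)).biUnion fun i => (G.frame i).support.image Prod.snd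

/-- The game with the first frame repeated twice more and the last one repeated forever. -/
noncomputable def padded (j : ℕ) : Frame := G.frame (min (j - 2) G.n)

/-- The padded frames as functions of labels. -/
noncomputable def weights (j : ℕ) (s : G.xs) (t : G.ys) : ℝ≥0 :=
  G.padded j ((s : ℝ≥0), (t : ℝ≥0))

variable {G}

theorem mem_of_padded_ne_zero {j : ℕ} {x y : ℝ≥0} (h : G.padded j (x, y) ≠ 0) :
    x ∈ G.xs ∧ y ∈ G.ys := by
  have hi : min (j - 2) G.n ∈ Finset.range (G.n + 1) := by simp
  exact ⟨Finset.mem_biUnion.2 ⟨_, hi, Finset.mem_image.2 ⟨_, Finsupp.mem_support_iff.2 h, rfl⟩⟩,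
    Finset.mem_biUnion.2 ⟨_, hi, Finset.mem_image.2 ⟨_, Finsupp.mem_support_iff.2 h, rfl⟩⟩⟩

theorem padded_of_le {j : ℕ} (hj : j ≤ 2) :
    G.padded j = Finsupp.single (0, 1) (1 / 2) + Finsupp.single (1, 0) (1 / 2) := by
  rw [padded, Nat.sub_eq_zero_of_le hj, Nat.zero_min, G.initial]

theorem padded_of_ge {j : ℕ} (hj : G.n + 2 ≤ j) : G.padded j = Finsupp.single (G.β, G.α) 1 := by
  rw [padded, min_eq_right (by omega), G.final]

/-- Each padded transition is trivial or a game transition shifted by `2`; the even shift preserves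
which party's coordinate moves. -/
theorem padded_cases (j : ℕ) : G.padded j = G.padded (j + 1) ∨
    ∃ i < G.n, j = i + 2 ∧ G.padded j = G.frame i ∧ G.padded (j + 1) = G.frame (i + 1) := by
  by_cases h : 2 ≤ j ∧ j - 2 < G.n
  · refine Or.inr ⟨j - 2, h.2, by omega, ?_, ?_⟩
    · rw [padded, min_eq_left (by omega)]
    · rw [padded]; congr 1; omega
  · left
    rw [padded, padded]; congr 1; omega

theorem IsTEF.dominates_odd (hG : G.IsTEF) {j : ℕ} (hj : Odd j) (t : G.ys) :
    Dominates (fun s : G.xs => (s : ℝ≥0)) (fun s => G.weights j s t) (fun s : G.xs => (s : ℝ≥0))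
      (fun s => G.weights (j + 1) s t) := by
  rcases padded_cases (G := G) j with h | ⟨i, hi, rfl, h1, h2⟩
  · have : G.weights (j + 1) = G.weights j := by
      ext s t
      rw [weights, weights, h]
    rw [this]
    exact Dominates.refl _ _
  · have hi' : Odd i := by simpa [Nat.odd_add] using hj
    have hT := (hG i hi).2 hi' t
    rw [← h1, ← h2] at hT
    exact hT.dominates Subtype.val_injective (fun z hz => ⟨⟨z, (mem_of_padded_ne_zero hz).1⟩, rfl⟩)
      (fun z hz => ⟨⟨z, (mem_of_padded_ne_zero hz).1⟩, rfl⟩)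

theorem IsTEF.dominates_even (hG : G.IsTEF) {j : ℕ} (hj : Even j) (s : G.xs) :
    Dominates (fun t : G.ys => (t : ℝ≥0)) (G.weights j s) (fun t : G.ys => (t : ℝ≥0))
      (G.weights (j + 1) s) := by
  rcases padded_cases (G := G) j with h | ⟨i, hi, rfl, h1, h2⟩
  · have : G.weights (j + 1) = G.weights j := by
      ext s t
      rw [weights, weights, h]
    rw [this]
    exact Dominates.refl _ _
  · have hi' : Even i := by simpa [Nat.even_add] using hj
    have hT := (hG i hi).1 hi' s
    rw [← h1, ← h2] at hT
    exact hT.dominates Subtype.val_injective (fun z hz => ⟨⟨z, (mem_of_padded_ne_zero hz).2⟩, rfl⟩)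
      (fun z hz => ⟨⟨z, (mem_of_padded_ne_zero hz).2⟩, rfl⟩)

theorem initial_mem : (0 : ℝ≥0) ∈ G.xs ∧ (1 : ℝ≥0) ∈ G.xs ∧ (0 : ℝ≥0) ∈ G.ys ∧ (1 : ℝ≥0) ∈ G.ys := by
  have h1 : G.padded 0 (0, 1) ≠ 0 := by
    rw [padded_of_le (by norm_num)]; simp
  have h2 : G.padded 0 (1, 0) ≠ 0 := by
    rw [padded_of_le (by norm_num)]; simp
  exact ⟨(mem_of_padded_ne_zero h1).1, (mem_of_padded_ne_zero h2).1,
    (mem_of_padded_ne_zero h2).2, (mem_of_padded_ne_zero h1).2⟩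

theorem sum_initial (φ : G.xs → G.ys → ℝ) {j : ℕ} (hj : j ≤ 2) :
    ∑ s, ∑ t, φ s t * (G.weights j s t : ℝ) =
      φ ⟨0, initial_mem.1⟩ ⟨1, initial_mem.2.2.2⟩ * (1 / 2) +
      φ ⟨1, initial_mem.2.1⟩ ⟨0, initial_mem.2.2.1⟩ * (1 / 2) := by
  have h1 := sum_mul_single φ ⟨0, initial_mem.1⟩ ⟨1, initial_mem.2.2.2⟩ (1 / 2)
  have h2 := sum_mul_single φ ⟨1, initial_mem.2.1⟩ ⟨0, initial_mem.2.2.1⟩ (1 / 2)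
  simp only [weights, padded_of_le hj, Finsupp.add_apply, NNReal.coe_add, mul_add,
    Finset.sum_add_distrib]
  rw [h1, h2]
  simp

theorem initial_support {j : ℕ} (hj : j ≤ 2) {s : G.xs} {t : G.ys} (h : G.weights j s t ≠ 0) :
    ((s : ℝ≥0) = 0 ∧ (t : ℝ≥0) = 1) ∨ ((s : ℝ≥0) = 1 ∧ (t : ℝ≥0) = 0) := by
  rw [weights, padded_of_le hj, Finsupp.add_apply, Finsupp.single_apply, Finsupp.single_apply] at h
  by_contra hc
  push Not at hc
  refine h ?_
  rw [if_neg, if_neg, add_zero]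
  · rintro e
    rw [Prod.mk.injEq] at e
    exact hc.2 e.1.symm e.2.symm
  · rintro e
    rw [Prod.mk.injEq] at e
    exact hc.1 e.1.symm e.2.symm

/-- No weight is lost by restricting to labels, because they cover every coordinate in the support
of the frames. -/
theorem sum_weights (j : ℕ) (z : ℝ≥0 × ℝ≥0) :
    ∑ s, ∑ t, (if ((s : G.xs) : ℝ≥0) = z.1 then 1 else 0) * (if ((t : G.ys) : ℝ≥0) = z.2 then 1 else 0) *
      (G.weights j s t : ℝ) = (G.padded j z : ℝ) := by
  obtain ⟨x, y⟩ := z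
  by_cases h : G.padded j (x, y) = 0
  · rw [h, Finset.sum_eq_zero]
    · simp
    · intro s _
      refine Finset.sum_eq_zero fun t _ => ?_
      split_ifs with h1 h2 <;> simp_all [weights]
  · obtain ⟨hx, hy⟩ := mem_of_padded_ne_zero h
    rw [Finset.sum_eq_single ⟨x, hx⟩, Finset.sum_eq_single ⟨y, hy⟩]
    · simp [weights]
    · intro t _ ht
      have : ¬ (t : ℝ≥0) = y := fun e => ht (Subtype.ext e)
      simp [this]
    · simp
    · intro s _ hs
      have : ¬ (s : ℝ≥0) = x := fun e => hs (Subtype.ext e)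
      simp [this]
    · simp

end PointGame

/-! ### Final measurements and assembly of the protocol -/

theorem normSq_single {ι : Type} [Fintype ι] [DecidableEq ι] (i : ι) :
    normSq (Pi.single i 1 : ι → ℂ) = 1 := by
  rw [normSq, Finset.sum_eq_single i]
  · simp
  · intro j _ hj; simp [hj]
  · simp

theorem expect_diagonal_single {ι : Type} [Fintype ι] [DecidableEq ι] (d : ι → ℝ) (i : ι) :
    expect (Matrix.diagonal fun i => (d i : ℂ)) (Pi.single i 1 : ι → ℂ) = d i := by
  rw [expect_diagonal, Finset.sum_eq_single i]
  · simp
  · intro j _ hj; simp [hj]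
  · simp

theorem diagonal_mulVec_gameState {S T : Type} [Fintype S] [Fintype T] [DecidableEq S]
    [DecidableEq T] (w₁ : Option S → ℝ) (w₂ : Option T → ℝ) (f : S → T → ℝ≥0) :
    ((Matrix.diagonal fun o => (w₁ o : ℂ)) ⊗ₖ ((1 : Matrix (S × T) (S × T) ℂ) ⊗ₖ
      Matrix.diagonal fun o => (w₂ o : ℂ))) *ᵥ gameState f =
      fun p => ((w₁ p.1 * w₂ p.2.2 : ℝ) : ℂ) * gameState f p := by
  rw [kronecker_diagonal]
  ext p
  rw [Matrix.mulVec_diagonal]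

theorem diagonal_mulVec_gameState_eq_zero {S T : Type} [Fintype S] [Fintype T] [DecidableEq S]
    [DecidableEq T] {w₁ : Option S → ℝ} {w₂ : Option T → ℝ} {f : S → T → ℝ≥0}
    (h : ∀ s t, f s t ≠ 0 → w₁ (some s) * w₂ (some t) = 0) :
    ((Matrix.diagonal fun o => (w₁ o : ℂ)) ⊗ₖ ((1 : Matrix (S × T) (S × T) ℂ) ⊗ₖ
      Matrix.diagonal fun o => (w₂ o : ℂ))) *ᵥ gameState f = 0 := by
  rw [diagonal_mulVec_gameState]
  ext ⟨a, ⟨s, t⟩, b⟩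
  simp only [gameState, Pi.zero_apply]
  split_ifs with hab
  · obtain ⟨rfl, rfl⟩ := hab
    by_cases hf : f s t = 0
    · simp [hf]
    · rw [h s t hf]; simp
  · simp

theorem normSq_diagonal_mulVec_gameState {S T : Type} [Fintype S] [Fintype T] [DecidableEq S]
    [DecidableEq T] (w₁ : Option S → ℝ) (w₂ : Option T → ℝ) (f : S → T → ℝ≥0) :
    normSq (((Matrix.diagonal fun o => (w₁ o : ℂ)) ⊗ₖ ((1 : Matrix (S × T) (S × T) ℂ) ⊗ₖ
      Matrix.diagonal fun o => (w₂ o : ℂ))) *ᵥ gameState f) =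
      ∑ s, ∑ t, (w₁ (some s) * w₂ (some t)) ^ 2 * f s t := by
  rw [diagonal_mulVec_gameState, normSq, ← sum_gameState f (fun a b => (w₁ a * w₂ b) ^ 2)]
  refine Finset.sum_congr rfl fun p _ => ?_
  rw [norm_mul, mul_pow, Complex.norm_real, Real.norm_eq_abs, sq_abs]

/-- The outcome weights of the final measurement: `1` on the label at position `1` for `true`, and
the complementary weights for `false`. -/
noncomputable def outcome {s : Finset ℝ≥0} (b : Bool) (o : Option s) : ℝ :=
  if b then atOne o else 1 - atOne o

theorem outcome_nonneg {s : Finset ℝ≥0} (b : Bool) (o : Option s) : 0 ≤ outcome b o := by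
  cases b
  · simp [outcome, atOne_le_one]
  · simp [outcome, atOne_nonneg]

theorem outcome_add {s : Finset ℝ≥0} :
    (Matrix.diagonal fun o : Option s => (outcome false o : ℂ)) +
      (Matrix.diagonal fun o : Option s => (outcome true o : ℂ)) = 1 := by
  rw [Matrix.diagonal_add, ← Matrix.diagonal_one]
  congr 1
  ext o
  simp [outcome]

/-- A protocol and dual feasible certificates for a point game satisfying the TEF constraint. -/
theorem PointGame.IsTEF.exists_protocol {G : PointGame} (hG : G.IsTEF) :
    ∃ (a m b : Type) (_ : Fintype a) (_ : Fintype m) (_ : Fintype b)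
      (_ : DecidableEq a) (_ : DecidableEq m) (_ : DecidableEq b)
      (P : Protocol a m b) (ZA : ℕ → Matrix a a ℂ) (ZB : ℕ → Matrix b b ℂ),
      P.IsDualFeasible ZA ZB ∧
      P.HasPointGame ZA ZB G ∧
      expect (ZA 0) P.ψA = (G.β : ℝ) ∧
      expect (ZB 0) P.ψB = (G.α : ℝ) ∧
      P.cheatB ≤ (G.β : ℝ≥0∞) ∧
      P.cheatA ≤ (G.α : ℝ≥0∞) := by
  -- An even number that is at least `G.n + 2`, so the padded game has reached its final frame by
  -- index `N`.
  obtain ⟨N, hN⟩ : ∃ N, N = 2 * (G.n + 1) := ⟨_, rfl⟩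
  have hNe : Even N := ⟨G.n + 1, by omega⟩
  have hfin : G.padded N = Finsupp.single (G.β, G.α) 1 := PointGame.padded_of_ge (by omega)
  obtain ⟨hβ, hα⟩ : G.β ∈ G.xs ∧ G.α ∈ G.ys :=
    PointGame.mem_of_padded_ne_zero (j := N) (by rw [hfin]; simp)
  have hA : ∀ i, ∃ U E : Matrix (Option G.xs × (G.xs × G.ys)) (Option G.xs × (G.xs × G.ys)) ℂ,
      i + 1 ≤ N → Odd (i + 1) →
      U ∈ Matrix.unitaryGroup (Option G.xs × (G.xs × G.ys)) ℂ ∧ IsStarProjection E ∧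
      liftA U *ᵥ gameState (G.weights (N - i)) = gameState (G.weights (N - (i + 1))) ∧
      liftA E *ᵥ gameState (G.weights (N - (i + 1))) = gameState (G.weights (N - (i + 1))) ∧
      ∀ d : Option G.xs → ℝ, d none = 0 → (∀ s : G.xs, d (some s) ≤ ((s : ℝ≥0) : ℝ)) →
        LoewnerGE ((Matrix.diagonal fun o => (position o : ℂ)) ⊗ₖ
            (1 : Matrix (G.xs × G.ys) (G.xs × G.ys) ℂ))
          (Uᴴ * E * ((Matrix.diagonal fun o => (d o : ℂ)) ⊗ₖ
            (1 : Matrix (G.xs × G.ys) (G.xs × G.ys) ℂ)) * E * U) := by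
    intro i
    by_cases h : i + 1 ≤ N ∧ Odd (i + 1)
    · have hj : Odd (N - (i + 1)) := Nat.Even.sub_odd h.1 hNe h.2
      obtain ⟨U, E, h1, h2, h3, h4, h5⟩ := exists_step_alice (fun s : G.xs => (s : ℝ≥0)) _ _
        (fun t => hG.dominates_odd hj t)
      rw [show N - (i + 1) + 1 = N - i by omega] at h3
      exact ⟨U, E, fun _ _ => ⟨h1, h2, h3, h4, fun d hd hd' =>
        h5 d position hd hd' (fun _ => rfl) le_rfl⟩⟩
    · exact ⟨1, 1, fun h1 h2 => absurd ⟨h1, h2⟩ h⟩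
  have hB : ∀ i, ∃ U E : Matrix ((G.xs × G.ys) × Option G.ys) ((G.xs × G.ys) × Option G.ys) ℂ,
      i + 1 ≤ N → Even (i + 1) →
      U ∈ Matrix.unitaryGroup ((G.xs × G.ys) × Option G.ys) ℂ ∧ IsStarProjection E ∧
      liftB U *ᵥ gameState (G.weights (N - i)) = gameState (G.weights (N - (i + 1))) ∧
      liftB E *ᵥ gameState (G.weights (N - (i + 1))) = gameState (G.weights (N - (i + 1))) ∧
      ∀ d : Option G.ys → ℝ, d none = 0 → (∀ s : G.ys, d (some s) ≤ ((s : ℝ≥0) : ℝ)) →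
        LoewnerGE ((1 : Matrix (G.xs × G.ys) (G.xs × G.ys) ℂ) ⊗ₖ
            (Matrix.diagonal fun o => (position o : ℂ)))
          (Uᴴ * E * ((1 : Matrix (G.xs × G.ys) (G.xs × G.ys) ℂ) ⊗ₖ
            (Matrix.diagonal fun o => (d o : ℂ))) * E * U) := by
    intro i
    by_cases h : i + 1 ≤ N ∧ Even (i + 1)
    · have hj : Even (N - (i + 1)) := (Nat.even_sub h.1).2 (iff_of_true hNe h.2)
      obtain ⟨U, E, h1, h2, h3, h4, h5⟩ := exists_step_bob (fun s : G.ys => (s : ℝ≥0)) _ _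
        (fun t => hG.dominates_even hj t)
      rw [show N - (i + 1) + 1 = N - i by omega] at h3
      exact ⟨U, E, fun _ _ => ⟨h1, h2, h3, h4, fun d hd hd' =>
        h5 d position hd hd' (fun _ => rfl) le_rfl⟩⟩
    · exact ⟨1, 1, fun h1 h2 => absurd ⟨h1, h2⟩ h⟩
  choose UA EA hA using hA
  choose UB EB hB using hB
  let D : ProtocolData (Option G.xs) (G.xs × G.ys) (Option G.ys) :=
    { n := N
      ψA := Pi.single (some ⟨G.β, hβ⟩) 1
      ψM := Pi.single (⟨G.β, hβ⟩, ⟨G.α, hα⟩) 1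
      ψB := Pi.single (some ⟨G.α, hα⟩) 1
      UA := fun i => UA (i - 1)
      UB := fun i => UB (i - 1)
      EA := fun i => EA (i - 1)
      EB := fun i => EB (i - 1)
      PA := fun j => Matrix.diagonal fun o => (outcome (j == 1) o : ℂ)
      PB := fun j => Matrix.diagonal fun o => (outcome (j == 0) o : ℂ) }
  have hhon : ∀ i ≤ N, D.honest i = gameState (G.weights (N - i)) := by
    intro i
    induction i with
    | zero =>
      intro _
      refine (gameState_single (⟨G.β, hβ⟩ : G.xs) (⟨G.α, hα⟩ : G.ys) _ fun s t => ?_).symm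
      simp [PointGame.weights, hfin, Finsupp.single_apply, Subtype.ext_iff, eq_comm]
    | succ i ih =>
      intro hi
      rw [ProtocolData.honest, ih (by omega)]
      split_ifs with ho
      · exact (hA i hi ho).2.2.1
      · exact (hB i hi (Nat.not_odd_iff_even.1 ho)).2.2.1
  have hhonN : D.honest D.n = gameState (G.weights 0) := by
    simpa using hhon N le_rfl
  have hjoint : ∀ j k : Fin 2, D.joint j k *ᵥ D.honest D.n =
      ((Matrix.diagonal fun o => (outcome (j == 1) o : ℂ)) ⊗ₖ
        ((1 : Matrix (G.xs × G.ys) (G.xs × G.ys) ℂ) ⊗ₖ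
          Matrix.diagonal fun o => (outcome (k == 0) o : ℂ))) *ᵥ gameState (G.weights 0) := by
    intro j k
    rw [hhonN]; rfl
  let P : Protocol (Option G.xs) (G.xs × G.ys) (Option G.ys) :=
    { toProtocolData := D
      n_even := hNe
      ψA_unit := normSq_single _
      ψM_unit := normSq_single _
      ψB_unit := normSq_single _
      UA_unitary := by
        rintro (_ | i) hi ho
        · simp at ho
        · exact (hA i hi ho).1
      UB_unitary := by
        rintro (_ | i) hi ho h0
        · simp at h0
        · exact (hB i hi ho).1
      EA_proj := by
        rintro (_ | i) hi ho
        · simp at ho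
        · exact (hA i hi ho).2.1
      EB_proj := by
        rintro (_ | i) hi ho h0
        · simp at h0
        · exact (hB i hi ho).2.1
      EA_honest := by
        rintro (_ | i) hi ho
        · simp at ho
        · rw [hhon _ hi]
          exact (hA i hi ho).2.2.2.1
      EB_honest := by
        rintro (_ | i) hi ho h0
        · simp at h0
        · rw [hhon _ hi]
          exact (hB i hi ho).2.2.2.1
      PA_psd := fun j => diagonal_posSemidef (outcome_nonneg _)
      PB_psd := fun j => diagonal_posSemidef (outcome_nonneg _)
      PA_sum := outcome_add
      PB_sum := by rw [add_comm]; exact outcome_add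
      correct₀₁ := by
        rw [hjoint]
        refine diagonal_mulVec_gameState_eq_zero fun s t hst => ?_
        rcases PointGame.initial_support (Nat.zero_le 2) hst with ⟨h1, h2⟩ | ⟨h1, h2⟩ <;>
          simp [outcome, atOne, h1, h2]
      correct₁₀ := by
        rw [hjoint]
        refine diagonal_mulVec_gameState_eq_zero fun s t hst => ?_
        rcases PointGame.initial_support (Nat.zero_le 2) hst with ⟨h1, h2⟩ | ⟨h1, h2⟩ <;>
          simp [outcome, atOne, h1, h2]
      balanced₀ := by
        rw [hjoint, normSq_diagonal_mulVec_gameState, PointGame.sum_initial _ (Nat.zero_le 2)]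
        simp [outcome, atOne]
      balanced₁ := by
        rw [hjoint, normSq_diagonal_mulVec_gameState, PointGame.sum_initial _ (Nat.zero_le 2)]
        simp [outcome, atOne] }
  -- Alice's last turn is message `N - 1`, so her certificate switches to the indicator at index `N
  -- - 1`; Bob's last turn is `N`, so his switches at `N`. Idle turns thus leave the certificates
  -- unchanged.
  let dA : ℕ → Option G.xs → ℝ := fun i => if N ≤ i + 1 then atOne else position
  let dB : ℕ → Option G.ys → ℝ := fun i => if N ≤ i then atOne else position
  have hdA : ∀ i, (∀ o, 0 ≤ dA i o) ∧ dA i none = 0 ∧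
      ∀ s : G.xs, dA i (some s) ≤ ((s : ℝ≥0) : ℝ) := by
    intro i
    simp only [dA]
    split_ifs
    · exact ⟨atOne_nonneg, rfl, atOne_le⟩
    · exact ⟨position_nonneg, rfl, fun _ => le_rfl⟩
  have hdB : ∀ i, (∀ o, 0 ≤ dB i o) ∧ dB i none = 0 ∧
      ∀ s : G.ys, dB i (some s) ≤ ((s : ℝ≥0) : ℝ) := by
    intro i
    simp only [dB]
    split_ifs
    · exact ⟨atOne_nonneg, rfl, atOne_le⟩
    · exact ⟨position_nonneg, rfl, fun _ => le_rfl⟩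
  let ZA : ℕ → Matrix (Option G.xs) (Option G.xs) ℂ := fun i =>
    Matrix.diagonal fun o => (dA i o : ℂ)
  let ZB : ℕ → Matrix (Option G.ys) (Option G.ys) ℂ := fun i =>
    Matrix.diagonal fun o => (dB i o : ℂ)
  have hZ : P.IsDualFeasible ZA ZB := by
    refine ⟨fun i _ => diagonal_posSemidef (hdA i).1, fun i _ => diagonal_posSemidef (hdB i).1,
      fun i hi ho => ?_, fun i hi he => ?_, ?_, fun i hi he => ?_, fun i hi ho => ?_, ?_⟩
    · change i < N at hi
      have h : dA i = position := if_neg (by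
        intro h
        have : i + 1 = N := by omega
        exact Nat.not_even_iff_odd.2 ho (this ▸ hNe))
      have := (hA i hi ho).2.2.2.2 (dA (i + 1)) (hdA _).2.1 (hdA _).2.2
      rw [← h] at this
      exact this
    · change i < N at hi
      -- The two sides could differ only for `i + 2 = N`, which parity excludes.
      have : N ≤ i + 1 ↔ N ≤ i + 1 + 1 := by
        obtain ⟨k, hk⟩ := he
        omega
      simp only [ZA, dA, this]
    · have : dA N = atOne := if_pos (by omega)
      change (Matrix.diagonal fun o => (dA N o : ℂ)) = _
      rw [this]
      rfl
    · change i < N at hi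
      have h : dB i = position := if_neg (by omega)
      have := (hB i hi he).2.2.2.2 (dB (i + 1)) (hdB _).2.1 (hdB _).2.2
      rw [← h] at this
      exact this
    · change i < N at hi
      have : N ≤ i ↔ N ≤ i + 1 := by
        obtain ⟨k, hk⟩ := ho
        omega
      simp only [ZB, dB, this]
    · have : dB N = atOne := if_pos le_rfl
      change (Matrix.diagonal fun o => (dB N o : ℂ)) = _
      rw [this]
      rfl
  have hvalA : expect (ZA 0) P.ψA = (G.β : ℝ) := by
    have : dA 0 = position := if_neg (by omega)
    refine (expect_diagonal_single (dA 0) _).trans ?_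
    rw [this]
    rfl
  have hvalB : expect (ZB 0) P.ψB = (G.α : ℝ) := by
    have : dB 0 = position := if_neg (by omega)
    refine (expect_diagonal_single (dB 0) _).trans ?_
    rw [this]
    rfl
  have hgame : P.HasPointGame ZA ZB G := by
    -- The map forgets the padding: frames `0`, `1`, `2` all go to the first frame, and `k + 2` is a
    -- preimage of `k`.
    refine ⟨fun j => ⟨min (j - 2) G.n, by omega⟩, fun i j hij => ?_, fun k => ?_, fun j z => ?_⟩
    · have : (i : ℕ) ≤ j := hij
      exact Fin.mk_le_mk.2 (by omega)
    · have hk := k.2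
      refine ⟨⟨k + 2, ?_⟩, Fin.ext ?_⟩
      · change (k : ℕ) + 2 < N + 1
        omega
      · change min ((k : ℕ) + 2 - 2) G.n = k
        omega
    · have hj : (j : ℕ) ≤ N := Nat.lt_succ_iff.1 j.2
      change prob (ZA (N - j)) (ZB (N - j)) (D.honest (N - j)) z = (G.padded j z : ℝ)
      rw [hhon _ (Nat.sub_le _ _), Nat.sub_sub_self hj, ← PointGame.sum_weights]
      refine (prob_gameState _ _ _ _).trans ?_
      refine Finset.sum_congr rfl fun s _ => Finset.sum_congr rfl fun t _ => ?_
      by_cases h0 : G.weights j s t = 0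
      · simp [h0]
      -- The indicator is in use only for `j ≤ 1`, where the padded frame is the initial one; on its
      -- support the coordinates are `0` or `1`, so indicator and position agree.
      · have hs : dA (N - j) (some s) = ((s : ℝ≥0) : ℝ) := by
          simp only [dA]
          split_ifs with h
          · rcases PointGame.initial_support (j := j) (by omega) h0 with ⟨h1, h2⟩ | ⟨h1, h2⟩ <;>
              simp [atOne, h1]
          · rfl
        have ht : dB (N - j) (some t) = ((t : ℝ≥0) : ℝ) := by
          simp only [dB]
          split_ifs with h
          · rcases PointGame.initial_support (j := j) (by omega) h0 with ⟨h1, h2⟩ | ⟨h1, h2⟩ <;>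
              simp [atOne, h2]
          · rfl
        simp only [hs, ht, NNReal.coe_inj]
  refine ⟨Option G.xs, G.xs × G.ys, Option G.ys, inferInstance, inferInstance, inferInstance,
    inferInstance, inferInstance, inferInstance, P, ZA, ZB, hZ, hgame, hvalA, hvalB, ?_, ?_⟩
  · have := hZ.cheatB_le
    rwa [hvalA, ENNReal.ofReal_coe_nnreal] at this
  · have := hZ.cheatA_le
    rwa [hvalB, ENNReal.ofReal_coe_nnreal] at this

end WCF

theorem mainTheorem2 (G : WCF.PointGame) (hG : G.IsTEF) :
    ∃ (a m b : Type) (_ : Fintype a) (_ : Fintype m) (_ : Fintype b)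
      (_ : DecidableEq a) (_ : DecidableEq m) (_ : DecidableEq b)
      (P : WCF.Protocol a m b) (ZA : ℕ → Matrix a a ℂ) (ZB : ℕ → Matrix b b ℂ),
      P.IsDualFeasible ZA ZB ∧
      P.HasPointGame ZA ZB G ∧
      WCF.expect (ZA 0) P.ψA = (G.β : ℝ) ∧
      WCF.expect (ZB 0) P.ψB = (G.α : ℝ) ∧
      P.cheatB ≤ (G.β : ℝ≥0∞) ∧
      P.cheatA ≤ (G.α : ℝ≥0∞) :=
  hG.exists_protocol
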